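/- Let $g\ge 2$ and let $\Gamma$ be a finite trivalent graph (multiple edges and loops allowed) with $2g-2$ vertices, hence $3g-3$ edges, and let $e_0$ be an edge such that $\Gamma\setminus e_0$ is connected. Let $Z_g$ be the associated trivalent configuration of projective lines over $\mathbb{C}$: take one copy $P_e$ of $\mathbb{P}^1$ for each edge $e$, with the points $0,\infty\in P_e$ attached to the two ends of $e$, and for each vertex $v$ glue the three points attached to the three ends at $v$ to one node, a regular function near the node being a triple of regular functions on the three branches with a common value at the node (so that the node looks like the union of the coordinate axes $\{xy=yz=xz=0\}\subset\mathbb{C}^3$). Let $Z_g^0=Z_g\setminus\{q\}$, where $q$ is a smooth point of $Z_g$ on $P_{e_0}$, i.e. $q \in P_{e_0}\setminus\{0,\infty\}$. Let $\mathcal{O}$ be the structure sheaf of $Z_g^0$ in the Zariski topology, and let $\tilde T$ be the sheaf of balanced vector fields: its sections are the vector fields that are regular on each component, vanish at the nodes, and have rotation numbers that sum to zero at every node; here the rotation number, along a branch with local coordinate $t$ at the node, of the vector field $(\rho t+O(t^2))\partial_t$ is $\rho$. Let $A=\mathbb{C}[Y,Z]/(YZ-Y^3-Z^2)$, and let $\mathbb{C}=A/(Y,Z)$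 be the $A$-module on which $A$ acts by evaluation at $Y=Z=0$. Then $$H^0(\mathcal{O})\oplus H^1(\tilde T)\;\cong\; A$$ as $\mathbb{C}$-algebras, where on the left $H^0(\mathcal{O})$ has the product of functions and acts on $H^1(\tilde T)$, and the product of two elements of $H^1(\tilde T)$ is zero. Let $H^0(\mathcal{O})\oplus H^1(\tilde T)$ act on $H^1(\mathcal{O})\oplus H^0(\tilde T)$ through its projection to $H^0(\mathcal{O})$, which acts by multiplication. Then, for a suitable choice of the isomorphism above, $$H^1(\mathcal{O})\oplus H^0(\tilde T)\;\cong\; A\oplus\mathbb{C}^{2g-2}$$ as $A$-modules. -/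

import Mathlib

open CategoryTheory TopologicalSpace Opposite

noncomputable section

/-! ### The projective line over `ℂ` -/

/-- The maximal ideal `(x - z)` of `ℂ[x]`. -/
def pointIdeal (z : ℂ) : IsDedekindDomain.HeightOneSpectrum (Polynomial ℂ) where
  asIdeal := Ideal.span {Polynomial.X - Polynomial.C z}
  isPrime := by
    rw [Ideal.span_singleton_prime (Polynomial.X_sub_C_ne_zero z)]
    exact Polynomial.prime_X_sub_C z
  ne_bot := by
    rw [ne_eq, Ideal.span_singleton_eq_bot]
    exact Polynomial.X_sub_C_ne_zero z

open Classical in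
/-- The discrete valuation of the function field `ℂ(x)` of `ℙ¹` attached to a closed point of
`ℙ¹(ℂ) = ℂ ∪ {∞}`. In Mathlib's multiplicative convention `f` vanishes to order at least `n` at
`p` iff `pointVal p f ≤ exp (-n)`; in particular `f` is regular at `p` iff `pointVal p f ≤ 1`. -/
def pointVal : OnePoint ℂ → Valuation (RatFunc ℂ) (WithZero (Multiplicative ℤ))
  | OnePoint.infty => RatFunc.inftyValuation ℂ
  | OnePoint.some z => (pointIdeal z).valuation (RatFunc ℂ)

/-- The rational function `f` is regular at `p` and takes the value `c` there:
`f - c` lies in the maximal ideal of the local ring at `p`. -/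
def HasValueAt (p : OnePoint ℂ) (f : RatFunc ℂ) (c : ℂ) : Prop :=
  pointVal p (f - RatFunc.C c) ≤ WithZero.exp (-1)

theorem exp_neg_one_le_one : (WithZero.exp (-1) : WithZero (Multiplicative ℤ)) ≤ 1 := by
  rw [← WithZero.exp_zero, WithZero.exp_le_exp]
  norm_num

theorem pointVal_C_le (p : OnePoint ℂ) (c : ℂ) : pointVal p (RatFunc.C c) ≤ 1 := by
  rcases p with _ | z
  · rcases eq_or_ne c 0 with rfl | hc
    · simp
    · classical
      exact (RatFunc.inftyValuation.C ℂ hc).le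
  · have h := (pointIdeal z).valuation_le_one (K := RatFunc ℂ) (Polynomial.C c)
    exact (RatFunc.algebraMap_C c) ▸ h

theorem pointVal_mul_le {p : OnePoint ℂ} {f g : RatFunc ℂ} {a b : WithZero (Multiplicative ℤ)}
    (hf : pointVal p f ≤ a) (hg : pointVal p g ≤ b) : pointVal p (f * g) ≤ a * b := by
  rw [map_mul]
  exact mul_le_mul' hf hg

theorem HasValueAt.regular {p : OnePoint ℂ} {f : RatFunc ℂ} {c : ℂ} (h : HasValueAt p f c) :
    pointVal p f ≤ 1 := by
  have := (pointVal p).map_add_le (h.trans exp_neg_one_le_one) (pointVal_C_le p c)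
  rwa [sub_add_cancel] at this

theorem hasValueAt_C (p : OnePoint ℂ) (c : ℂ) : HasValueAt p (RatFunc.C c) c := by
  simp [HasValueAt]

theorem HasValueAt.add {p : OnePoint ℂ} {f g : RatFunc ℂ} {c d : ℂ} (hf : HasValueAt p f c)
    (hg : HasValueAt p g d) : HasValueAt p (f + g) (c + d) := by
  have := (pointVal p).map_add_le hf hg
  rwa [sub_add_sub_comm, ← map_add] at this

theorem HasValueAt.mul {p : OnePoint ℂ} {f g : RatFunc ℂ} {c d : ℂ} (hf : HasValueAt p f c)
    (hg : HasValueAt p g d) : HasValueAt p (f * g) (c * d) := by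
  have h1 := pointVal_mul_le hf hg.regular
  have h2 := pointVal_mul_le (pointVal_C_le p c) hg
  rw [mul_one] at h1
  rw [one_mul] at h2
  have := (pointVal p).map_add_le h1 h2
  rw [HasValueAt, map_mul]
  convert this using 2
  ring

/-- Rational vector fields on `ℙ¹`. -/
abbrev RatVec : Type := Derivation ℂ (RatFunc ℂ) (RatFunc ℂ)

/-- The rational vector field `D` is regular at `p`: it preserves the local ring at `p`. -/
def VecRegularAt (p : OnePoint ℂ) (D : RatVec) : Prop :=
  ∀ f : RatFunc ℂ, pointVal p f ≤ 1 → pointVal p (D f) ≤ 1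

/-- The vector field `D` is regular at `p`, vanishes at `p` and has rotation number `ρ` there: it
maps the maximal ideal `𝔪` of the local ring at `p` to itself, and it acts as multiplication by `ρ`
on `𝔪 / 𝔪²`. In terms of a local coordinate `t` at `p`, `D = (ρ t + O(t²)) ∂_t`. -/
def HasRotationAt (p : OnePoint ℂ) (D : RatVec) (ρ : ℂ) : Prop :=
  ∀ f : RatFunc ℂ, pointVal p f ≤ WithZero.exp (-1) →
    pointVal p (D f) ≤ WithZero.exp (-1) ∧
      pointVal p (D f - RatFunc.C ρ * f) ≤ WithZero.exp (-2)

theorem VecRegularAt.add {p : OnePoint ℂ} {D D' : RatVec} (h : VecRegularAt p D)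
    (h' : VecRegularAt p D') : VecRegularAt p (D + D') :=
  fun f hf => (pointVal p).map_add_le (h f hf) (h' f hf)

theorem VecRegularAt.smul {p : OnePoint ℂ} {D : RatVec} {g : RatFunc ℂ} (hg : pointVal p g ≤ 1)
    (h : VecRegularAt p D) : VecRegularAt p (g • D) := fun f hf => by
  simpa using pointVal_mul_le hg (h f hf)

theorem HasRotationAt.add {p : OnePoint ℂ} {D D' : RatVec} {ρ ρ' : ℂ} (h : HasRotationAt p D ρ)
    (h' : HasRotationAt p D' ρ') : HasRotationAt p (D + D') (ρ + ρ') := fun f hf => by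
  refine ⟨(pointVal p).map_add_le (h f hf).1 (h' f hf).1, ?_⟩
  have := (pointVal p).map_add_le (h f hf).2 (h' f hf).2
  rwa [sub_add_sub_comm, ← add_mul, ← map_add] at this

theorem HasRotationAt.smul {p : OnePoint ℂ} {D : RatVec} {g : RatFunc ℂ} {c ρ : ℂ}
    (hg : HasValueAt p g c) (h : HasRotationAt p D ρ) : HasRotationAt p (g • D) (c * ρ) :=
  fun f hf => by
  refine ⟨by simpa using pointVal_mul_le hg.regular (h f hf).1, ?_⟩
  have h1 := pointVal_mul_le hg.regular (h f hf).2
  have h2 := pointVal_mul_le (pointVal_mul_le hg (pointVal_C_le p ρ)) hf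
  rw [one_mul] at h1
  rw [mul_one, ← WithZero.exp_add] at h2
  have := (pointVal p).map_add_le h1 h2
  rw [map_mul, Derivation.smul_apply, smul_eq_mul]
  convert this using 2
  ring

/-! ### Trivalent configurations of projective lines -/

/-- A trivalent graph with vertices `V` and edges `E`; multiple edges and loops are allowed.
The end `false` of the edge `e` is the point `0` and the end `true` is the point `∞` of the
projective line attached to `e`. -/
structure TrivalentGraph (V E : Type) where
  /-- the vertex at an end of an edge -/
  endpt : E → Bool → V
  /-- there are exactly three ends of edges at every vertex -/
  trivalent : ∀ v, Nat.card {h : E × Bool // endpt h.1 h.2 = v} = 3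

/-- The point of `ℙ¹` at an end of an edge. -/
def endPoint : Bool → OnePoint ℂ
  | false => OnePoint.some 0
  | true => OnePoint.infty

namespace TrivalentGraph

variable {V E : Type}

/-- The graph remains connected after removal of the edge `e₀`. -/
def IsNonseparating (G : TrivalentGraph V E) (e₀ : E) : Prop :=
  ∀ v w : V, Relation.EqvGen
    (fun a b => ∃ e, e ≠ e₀ ∧ G.endpt e false = a ∧ G.endpt e true = b) v w

/-- The points of the curve `Z` obtained from one copy `P_e` of `ℙ¹` for every edge `e` by glueing,
for every vertex `v`, the points `0` or `∞` of the lines at the three ends at `v` to one node: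
the nodes, the smooth closed points `z ∈ ℂ ∖ {0}` of each `P_e`, and the generic points
of the `P_e`. -/
inductive Point (G : TrivalentGraph V E) : Type
  | node (v : V) : Point G
  | smooth (e : E) (z : ℂˣ) : Point G
  | generic (e : E) : Point G

/-- The Zariski topology: the closed sets are the unions of a set of components `P_e` and a set of
closed points that is finite on each component not in that set. -/
instance (G : TrivalentGraph V E) : TopologicalSpace (Point G) where
  IsOpen U := (∀ e b, Point.node (G.endpt e b) ∈ U → Point.generic e ∈ U) ∧
    (∀ e z, Point.smooth e z ∈ U → Point.generic e ∈ U) ∧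
    (∀ e, Point.generic e ∈ U → {z : ℂˣ | Point.smooth e z ∉ U}.Finite)
  isOpen_univ := by simp
  isOpen_inter := by
    rintro s t ⟨h1, h2, h3⟩ ⟨k1, k2, k3⟩
    refine ⟨fun e b h => ⟨h1 e b h.1, k1 e b h.2⟩, fun e z h => ⟨h2 e z h.1, k2 e z h.2⟩,
      fun e h => ((h3 e h.1).union (k3 e h.2)).subset fun z hz => ?_⟩
    simp only [Set.mem_ofPred_eq, Set.mem_inter_iff, Set.mem_union] at hz ⊢
    tauto
  isOpen_sUnion := by
    intro S hS
    refine ⟨?_, ?_, ?_⟩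
    · rintro e b ⟨t, ht, h⟩
      exact ⟨t, ht, (hS t ht).1 e b h⟩
    · rintro e z ⟨t, ht, h⟩
      exact ⟨t, ht, (hS t ht).2.1 e z h⟩
    · rintro e ⟨t, ht, h⟩
      exact ((hS t ht).2.2 e h).subset fun z hz h' => hz ⟨t, ht, h'⟩

/-- The configuration with the smooth point `q` of the component `P_{e₀}` removed. -/
abbrev Punctured (G : TrivalentGraph V E) (e₀ : E) (q : ℂˣ) : TopCat.{0} :=
  TopCat.of {p : Point G // p ≠ Point.smooth e₀ q}

variable {G : TrivalentGraph V E} {e₀ : E} {q : ℂˣ}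

/-- The generic point of a component. -/
def genericPt (G : TrivalentGraph V E) (e₀ : E) (q : ℂˣ) (e : E) : Punctured G e₀ q :=
  ⟨Point.generic e, by simp⟩

/-- The node at a vertex. -/
def nodePt (G : TrivalentGraph V E) (e₀ : E) (q : ℂˣ) (v : V) : Punctured G e₀ q :=
  ⟨Point.node v, by simp⟩

theorem generic_mem_of_smooth_mem {U : Opens (Punctured G e₀ q)} {e : E} {z : ℂˣ}
    (hz : Point.smooth e z ≠ Point.smooth e₀ q)
    (h : (⟨Point.smooth e z, hz⟩ : Punctured G e₀ q) ∈ U) : genericPt G e₀ q e ∈ U := by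
  obtain ⟨W, hW, hU⟩ := isOpen_induced_iff.1 U.isOpen
  have h' : Point.smooth e z ∈ W := by
    have : (⟨Point.smooth e z, hz⟩ : Punctured G e₀ q) ∈ (U : Set (Punctured G e₀ q)) := h
    rw [← hU] at this
    exact this
  have : genericPt G e₀ q e ∈ (U : Set (Punctured G e₀ q)) := by
    rw [← hU]
    exact hW.2.1 e z h'
  exact this

theorem generic_mem_of_node_mem {U : Opens (Punctured G e₀ q)} {e : E} {b : Bool}
    (h : nodePt G e₀ q (G.endpt e b) ∈ U) : genericPt G e₀ q e ∈ U := by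
  obtain ⟨W, hW, hU⟩ := isOpen_induced_iff.1 U.isOpen
  have h' : Point.node (G.endpt e b) ∈ W := by
    have : nodePt G e₀ q (G.endpt e b) ∈ (U : Set (Punctured G e₀ q)) := h
    rw [← hU] at this
    exact this
  have : genericPt G e₀ q e ∈ (U : Set (Punctured G e₀ q)) := by
    rw [← hU]
    exact hW.1 e b h'
  exact this

/-- The set of components that meet an open set `U`. -/
abbrev Comp (U : Opens (Punctured G e₀ q)) : Type := {e : E // genericPt G e₀ q e ∈ U}

/-- Restriction from an open set `U` to a smaller open set `W`. -/
def restr {M : Type} {U W : Opens (Punctured G e₀ q)} (h : W ≤ U) (s : Comp U → M) :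
    Comp W → M :=
  fun e => s ⟨e.1, h e.2⟩

/-- The ring `𝒪(U)` of regular functions on an open set `U`: families of rational functions on the
components that meet `U` which are regular at the smooth points of `U` and which are regular with
one common value at each node of `U`. -/
def regularFunctions (U : Opens (Punctured G e₀ q)) : Subalgebra ℂ (Comp U → RatFunc ℂ) where
  carrier := {f |
    (∀ (e : Comp U) (z : ℂˣ) (hz : Point.smooth e.1 z ≠ Point.smooth e₀ q),
      (⟨Point.smooth e.1 z, hz⟩ : Punctured G e₀ q) ∈ U →
        pointVal (OnePoint.some (z : ℂ)) (f e) ≤ 1) ∧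
    (∀ v, nodePt G e₀ q v ∈ U → ∃ c : ℂ, ∀ (e : Comp U) (b : Bool), G.endpt e.1 b = v →
      HasValueAt (endPoint b) (f e) c)}
  mul_mem' := by
    rintro f g ⟨hf, hf'⟩ ⟨hg, hg'⟩
    refine ⟨fun e z hz h => ?_, fun v hv => ?_⟩
    · simpa using pointVal_mul_le (hf e z hz h) (hg e z hz h)
    · obtain ⟨c, hc⟩ := hf' v hv
      obtain ⟨d, hd⟩ := hg' v hv
      exact ⟨c * d, fun e b h => (hc e b h).mul (hd e b h)⟩
  add_mem' := by
    rintro f g ⟨hf, hf'⟩ ⟨hg, hg'⟩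
    refine ⟨fun e z hz h => (pointVal _).map_add_le (hf e z hz h) (hg e z hz h), fun v hv => ?_⟩
    obtain ⟨c, hc⟩ := hf' v hv
    obtain ⟨d, hd⟩ := hg' v hv
    exact ⟨c + d, fun e b h => (hc e b h).add (hd e b h)⟩
  algebraMap_mem' := by
    intro c
    refine ⟨fun e z hz h => ?_, fun v hv => ⟨c, fun e b h => ?_⟩⟩
    · simpa [Pi.algebraMap_apply, RatFunc.algebraMap_eq_C] using pointVal_C_le _ c
    · simpa [Pi.algebraMap_apply, RatFunc.algebraMap_eq_C] using hasValueAt_C _ c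

theorem restr_regular {U W : Opens (Punctured G e₀ q)} (h : W ≤ U) {f : Comp U → RatFunc ℂ}
    (hf : f ∈ regularFunctions U) : restr h f ∈ regularFunctions W :=
  ⟨fun e z hz hW => hf.1 ⟨e.1, h e.2⟩ z hz (h hW), fun v hv => by
    obtain ⟨c, hc⟩ := hf.2 v (h hv)
    exact ⟨c, fun e b hb => hc ⟨e.1, h e.2⟩ b hb⟩⟩

/-- The ring `H⁰(𝒪)` of global regular functions. -/
def GlobalFunctions (G : TrivalentGraph V E) (e₀ : E) (q : ℂˣ) : Type :=
  regularFunctions (⊤ : Opens (Punctured G e₀ q))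

instance : CommRing (GlobalFunctions G e₀ q) :=
  inferInstanceAs (CommRing (regularFunctions (⊤ : Opens (Punctured G e₀ q))))

instance : Algebra ℂ (GlobalFunctions G e₀ q) :=
  inferInstanceAs (Algebra ℂ (regularFunctions (⊤ : Opens (Punctured G e₀ q))))

/-- A sheaf of `𝒪`-modules whose sections over `U` are families of elements of `M`, one for each
component that meets `U`, with the evident restriction maps. Here `M` is a vector space over the
function field `ℂ(x)` of the components. -/
structure SectionSheaf (G : TrivalentGraph V E) (e₀ : E) (q : ℂˣ) (M : Type) [AddCommGroup M]
    [Module (RatFunc ℂ) M] where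
  /-- the module of sections over an open set -/
  sec : ∀ U : Opens (Punctured G e₀ q), Submodule (regularFunctions U) (Comp U → M)
  /-- restrictions of sections are sections -/
  restr_mem : ∀ {U W : Opens (Punctured G e₀ q)} (h : W ≤ U) {s : Comp U → M},
    s ∈ sec U → restr h s ∈ sec W
  /-- being a section is a local property -/
  glue_mem : ∀ {ι : Type} (U : ι → Opens (Punctured G e₀ q)) (s : Comp (iSup U) → M),
    (∀ i, restr (le_iSup U i) s ∈ sec (U i)) → s ∈ sec (iSup U)

namespace SectionSheaf

variable {M : Type} [AddCommGroup M] [Module (RatFunc ℂ) M] (F : SectionSheaf G e₀ q M)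

/-- The underlying presheaf of abelian groups. -/
def presheaf : TopCat.Presheaf AddCommGrpCat.{0} (Punctured G e₀ q) where
  obj U := AddCommGrpCat.of (F.sec U.unop)
  map i := AddCommGrpCat.ofHom
    { toFun := fun s => ⟨restr i.unop.le s.1, F.restr_mem _ s.2⟩
      map_zero' := rfl
      map_add' := fun _ _ => rfl }
  map_id _ := rfl
  map_comp _ _ := rfl

theorem presheaf_isSheaf : F.presheaf.IsSheaf := by
  rw [TopCat.Presheaf.isSheaf_iff_isSheafUniqueGluing]
  intro ι U sf hsf
  have hcov : ∀ e : Comp (iSup U), ∃ i, genericPt G e₀ q e.1 ∈ U i := fun e =>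
    Opens.mem_iSup.1 e.2
  choose k hk using hcov
  have key : ∀ (i : ι) (e : E) (hi : genericPt G e₀ q e ∈ U i)
      (h : genericPt G e₀ q e ∈ iSup U),
      (sf (k ⟨e, h⟩) : F.sec _).1 ⟨e, hk ⟨e, h⟩⟩ = (sf i : F.sec _).1 ⟨e, hi⟩ := by
    intro i e hi h
    have := congrArg (fun t : F.sec (U (k ⟨e, h⟩) ⊓ U i) => t.1 ⟨e, hk ⟨e, h⟩, hi⟩)
      (hsf (k ⟨e, h⟩) i)
    exact this
  let s : Comp (iSup U) → M := fun e => (sf (k e) : F.sec _).1 ⟨e.1, hk e⟩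
  have hs : ∀ i, restr (le_iSup U i) s = (sf i : F.sec _).1 := fun i =>
    funext fun e => key i e.1 e.2 (le_iSup U i e.2)
  refine ⟨(⟨s, F.glue_mem U s fun i => ?_⟩ : F.sec (iSup U)), fun i => ?_, fun t ht => ?_⟩
  · rw [hs]
    exact (sf i : F.sec _).2
  · exact Subtype.ext (hs i)
  · refine Subtype.ext (funext fun e => ?_)
    have := congrArg (fun t : F.sec (U (k e)) => t.1 ⟨e.1, hk e⟩) (ht (k e))
    exact this

/-- The underlying sheaf of abelian groups. -/
def sheaf : CategoryTheory.Sheaf (Opens.grothendieckTopology (Punctured G e₀ q))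
    AddCommGrpCat.{0} :=
  ⟨F.presheaf, F.presheaf_isSheaf⟩

/-- `H⁰`: the global sections, a module over the ring of global regular functions. -/
def H0 : Type := F.sec ⊤

instance : AddCommGroup F.H0 := inferInstanceAs (AddCommGroup (F.sec ⊤))

instance : Module (GlobalFunctions G e₀ q) F.H0 :=
  inferInstanceAs (Module (regularFunctions (⊤ : Opens (Punctured G e₀ q))) (F.sec ⊤))

/-- `H¹`: the first sheaf cohomology group. -/
def H1 : Type := CategoryTheory.Sheaf.H.{0} F.sheaf 1

instance : AddCommGroup F.H1 :=
  inferInstanceAs (AddCommGroup (CategoryTheory.Sheaf.H.{0} F.sheaf 1))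

/-- Multiplication by a global regular function, as an endomorphism of the sheaf. -/
def mulEnd (a : GlobalFunctions G e₀ q) : F.sheaf ⟶ F.sheaf :=
  ⟨{ app := fun U => AddCommGrpCat.ofHom (DistribSMul.toAddMonoidHom (F.sec U.unop)
        (⟨restr le_top a.1, restr_regular le_top a.2⟩ : regularFunctions U.unop))
     naturality := fun _ _ _ => rfl }⟩

theorem mulEnd_ext {φ ψ : F.sheaf ⟶ F.sheaf}
    (h : ∀ (U : (Opens (Punctured G e₀ q))ᵒᵖ) (s : F.sec U.unop),
      (φ.hom.app U).hom s = (ψ.hom.app U).hom s) : φ = ψ := by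
  apply CategoryTheory.Sheaf.hom_ext
  ext U s
  exact h U s

/-- `H¹` is a module over the global regular functions: a function acts by the map that
multiplication by this function induces on cohomology. -/
instance : Module (GlobalFunctions G e₀ q) F.H1 where
  smul a x := CategoryTheory.Sheaf.H.map (F.mulEnd a) 1 x
  one_smul x := by
    have : F.mulEnd 1 = 𝟙 F.sheaf := F.mulEnd_ext fun U s =>
      one_smul (regularFunctions U.unop) s
    exact (congrArg (fun φ => CategoryTheory.Sheaf.H.map φ 1 x) this).trans
      (CategoryTheory.Sheaf.H.map_id_apply x)
  mul_smul a b x := by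
    have : F.mulEnd (a * b) = F.mulEnd b ≫ F.mulEnd a := F.mulEnd_ext fun U s =>
      mul_smul (⟨restr le_top a.1, restr_regular le_top a.2⟩ : regularFunctions U.unop)
        (⟨restr le_top b.1, restr_regular le_top b.2⟩ : regularFunctions U.unop) s
    exact (congrArg (fun φ => CategoryTheory.Sheaf.H.map φ 1 x) this).trans
      (CategoryTheory.Sheaf.H.map_comp_apply _ _ x)
  smul_zero a := map_zero (CategoryTheory.Sheaf.H.map (F.mulEnd a) 1)
  smul_add a := map_add (CategoryTheory.Sheaf.H.map (F.mulEnd a) 1)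
  add_smul a b x := by
    have : F.mulEnd (a + b) = F.mulEnd a + F.mulEnd b := F.mulEnd_ext fun U s =>
      add_smul (⟨restr le_top a.1, restr_regular le_top a.2⟩ : regularFunctions U.unop)
        (⟨restr le_top b.1, restr_regular le_top b.2⟩ : regularFunctions U.unop) s
    exact (congrArg (fun φ => CategoryTheory.Sheaf.H.map φ 1 x) this).trans
      (CategoryTheory.Sheaf.H.map_add_apply _ _ x)
  zero_smul x := by
    have : F.mulEnd 0 + F.mulEnd 0 = F.mulEnd 0 := F.mulEnd_ext fun U s => by
      have h := zero_smul (regularFunctions U.unop) s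
      exact (congrArg₂ (· + ·) h h).trans ((add_zero _).trans h.symm)
    have h := (CategoryTheory.Sheaf.H.map_add_apply (F.mulEnd 0) (F.mulEnd 0) x).symm.trans
      (congrArg (fun φ => CategoryTheory.Sheaf.H.map φ 1 x) this)
    exact add_eq_left.1 h

/-- The right action of the (commutative) ring of global functions on `H¹`; it coincides with the
left one. -/
instance : Module (GlobalFunctions G e₀ q)ᵐᵒᵖ F.H1 :=
  Module.compHom F.H1
    ((RingHom.id (GlobalFunctions G e₀ q)).fromOpposite mul_comm)

instance : IsCentralScalar (GlobalFunctions G e₀ q) F.H1 :=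
  ⟨fun _ _ => rfl⟩

instance : SMulCommClass (GlobalFunctions G e₀ q)
    (GlobalFunctions G e₀ q)ᵐᵒᵖ F.H1 :=
  ⟨fun a b x => by
    have h : a • b.unop • x = b.unop • a • x := by
      rw [← mul_smul, ← mul_smul, mul_comm]
    exact h⟩

instance : Module ℂ F.H1 :=
  Module.compHom F.H1 (algebraMap ℂ (GlobalFunctions G e₀ q))

instance : IsScalarTower ℂ (GlobalFunctions G e₀ q) F.H1 :=
  IsScalarTower.of_algebraMap_smul fun _ _ => rfl

instance : IsScalarTower ℂ (GlobalFunctions G e₀ q)ᵐᵒᵖ F.H1 :=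
  ⟨fun c a x => by
    have := smul_assoc c a.unop x
    exact this⟩

end SectionSheaf

/-- The structure sheaf `𝒪` as a module over itself. -/
def structureSheaf (G : TrivalentGraph V E) (e₀ : E) (q : ℂˣ) :
    SectionSheaf G e₀ q (RatFunc ℂ) where
  sec U :=
    { carrier := regularFunctions U
      add_mem' := add_mem
      zero_mem' := zero_mem _
      smul_mem' := fun a _ hs => mul_mem a.2 hs }
  restr_mem h _ hs := restr_regular h hs
  glue_mem U s hs := by
    refine ⟨fun e z hz h => ?_, fun v hv => ?_⟩
    · obtain ⟨i, hi⟩ := Opens.mem_iSup.1 h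
      have he : genericPt G e₀ q e.1 ∈ U i := generic_mem_of_smooth_mem hz hi
      exact (hs i).1 ⟨e.1, he⟩ z hz hi
    · obtain ⟨i, hi⟩ := Opens.mem_iSup.1 hv
      obtain ⟨c, hc⟩ := (hs i).2 v hi
      refine ⟨c, fun e b hb => ?_⟩
      have he : genericPt G e₀ q e.1 ∈ U i := by
        subst hb
        exact generic_mem_of_node_mem hi
      exact hc ⟨e.1, he⟩ b hb

/-- The sheaf `T̃` of balanced vector fields: its sections over `U` are the families of rational
vector fields on the components that meet `U` which are regular at the smooth points of `U`, and
which vanish at the nodes of `U` with rotation numbers that sum to zero at each node. -/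
def balancedVectorFields [Fintype E] [DecidableEq V] (G : TrivalentGraph V E) (e₀ : E) (q : ℂˣ) :
    SectionSheaf G e₀ q RatVec where
  sec U :=
    { carrier := {D |
        (∀ (e : Comp U) (z : ℂˣ) (hz : Point.smooth e.1 z ≠ Point.smooth e₀ q),
          (⟨Point.smooth e.1 z, hz⟩ : Punctured G e₀ q) ∈ U →
            VecRegularAt (OnePoint.some (z : ℂ)) (D e)) ∧
        (∀ v, nodePt G e₀ q v ∈ U → ∃ ρ : E × Bool → ℂ,
          (∀ (e : Comp U) (b : Bool), G.endpt e.1 b = v →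
            HasRotationAt (endPoint b) (D e) (ρ (e.1, b))) ∧
          ∑ h : E × Bool with G.endpt h.1 h.2 = v, ρ h = 0)}
      add_mem' := by
        rintro D D' ⟨h1, h2⟩ ⟨k1, k2⟩
        refine ⟨fun e z hz h => (h1 e z hz h).add (k1 e z hz h), fun v hv => ?_⟩
        obtain ⟨ρ, hρ, hs⟩ := h2 v hv
        obtain ⟨σ, hσ, ht⟩ := k2 v hv
        refine ⟨ρ + σ, fun e b h => (hρ e b h).add (hσ e b h), ?_⟩
        simp [Finset.sum_add_distrib, hs, ht]
      zero_mem' := by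
        refine ⟨fun e z hz h f hf => by simp, fun v hv => ⟨0, fun e b h f hf => by simp, by simp⟩⟩
      smul_mem' := by
        rintro a D ⟨h1, h2⟩
        refine ⟨fun e z hz h => (h1 e z hz h).smul (a.2.1 e z hz h), fun v hv => ?_⟩
        obtain ⟨ρ, hρ, hs⟩ := h2 v hv
        obtain ⟨c, hc⟩ := a.2.2 v hv
        refine ⟨fun h => c * ρ h, fun e b h => (hρ e b h).smul (hc e b h), ?_⟩
        rw [← Finset.mul_sum, hs, mul_zero] }
  restr_mem h D hD :=
    ⟨fun e z hz hW => hD.1 ⟨e.1, h e.2⟩ z hz (h hW), fun v hv => by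
      obtain ⟨ρ, hρ, hs⟩ := hD.2 v (h hv)
      exact ⟨ρ, fun e b hb => hρ ⟨e.1, h e.2⟩ b hb, hs⟩⟩
  glue_mem U s hs := by
    refine ⟨fun e z hz h => ?_, fun v hv => ?_⟩
    · obtain ⟨i, hi⟩ := Opens.mem_iSup.1 h
      have he : genericPt G e₀ q e.1 ∈ U i := generic_mem_of_smooth_mem hz hi
      exact (hs i).1 ⟨e.1, he⟩ z hz hi
    · obtain ⟨i, hi⟩ := Opens.mem_iSup.1 hv
      obtain ⟨ρ, hρ, ht⟩ := (hs i).2 v hi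
      refine ⟨ρ, fun e b hb => ?_, ht⟩
      have he : genericPt G e₀ q e.1 ∈ U i := by
        subst hb
        exact generic_mem_of_node_mem hi
      exact hρ ⟨e.1, he⟩ b hb

section Cohomology

variable [Fintype E] [DecidableEq V] (G : TrivalentGraph V E) (e₀ : E) (q : ℂˣ)

/-- The algebra `H⁰(𝒪) ⊕ H¹(T̃)`: the product on `H⁰(𝒪)` is the product of functions, `H⁰(𝒪)` acts
on `H¹(T̃)`, and the product of two elements of `H¹(T̃)` is zero. -/
def EvenCohomology : Type :=
  TrivSqZeroExt (GlobalFunctions G e₀ q) (G.balancedVectorFields e₀ q).H1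

instance : CommRing (EvenCohomology G e₀ q) :=
  inferInstanceAs (CommRing (TrivSqZeroExt (GlobalFunctions G e₀ q)
    (G.balancedVectorFields e₀ q).H1))

instance : Algebra ℂ (EvenCohomology G e₀ q) :=
  TrivSqZeroExt.algebra' ℂ (GlobalFunctions G e₀ q)
    (G.balancedVectorFields e₀ q).H1

/-- The group `H¹(𝒪) ⊕ H⁰(T̃)`. -/
abbrev OddCohomology : Type :=
  (G.structureSheaf e₀ q).H1 × (G.balancedVectorFields e₀ q).H0

/-- `H⁰(𝒪) ⊕ H¹(T̃)` acts on `H¹(𝒪) ⊕ H⁰(T̃)` through its projection to `H⁰(𝒪)`. -/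
instance : Module (EvenCohomology G e₀ q) (OddCohomology G e₀ q) :=
  Module.compHom (OddCohomology G e₀ q)
    (TrivSqZeroExt.fstHom ℂ (GlobalFunctions G e₀ q)
      (G.balancedVectorFields e₀ q).H1).toRingHom

end Cohomology

end TrivalentGraph

/-- The ideal `(YZ - Y³ - Z²)` of `ℂ[Y, Z]`, where `Y` and `Z` are the variables `0` and `1`. -/
def nodalCubicIdeal : Ideal (MvPolynomial (Fin 2) ℂ) :=
  Ideal.span {MvPolynomial.X 0 * MvPolynomial.X 1 - MvPolynomial.X 0 ^ 3 - MvPolynomial.X 1 ^ 2}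

/-- The algebra `A = ℂ[Y, Z] / (YZ - Y³ - Z²)`. -/
abbrev NodalCubic : Type := MvPolynomial (Fin 2) ℂ ⧸ nodalCubicIdeal

/-- The ideal `(Y, Z)` of `A`. -/
def nodeIdeal : Ideal NodalCubic :=
  Ideal.span {Ideal.Quotient.mk nodalCubicIdeal (MvPolynomial.X 0),
    Ideal.Quotient.mk nodalCubicIdeal (MvPolynomial.X 1)}

/-- The one-dimensional `A`-module `ℂ = A / (Y, Z)`, on which `A` acts through evaluation at the
node `Y = Z = 0`. -/
abbrev NodeModule : Type := NodalCubic ⧸ nodeIdeal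

end

/-! Everything is computed on the normalization, where $P_{e_0}\setminus q$ is an affine line with
coordinate $t=x/(x-q)$, equal to $0$ and $1$ at the two ends of $e_0$, and every other component is
a complete $\mathbb{P}^1$.

Functions. A global function is constant on each component other than $P_{e_0}$ and a polynomial
$P(t)$ on $P_{e_0}$. Since $\Gamma\setminus e_0$ is connected, all its node values agree, so it
amounts to a polynomial with $P(0)=P(1)$. With $Y=t-t^2$ and $Z=tY$ these polynomials form the ring
$A$ (`nodalMap_injective`, `exists_nodalMap_eq`, `globalEquiv`).

$H^1(\mathcal{O})$. On the normalization $H^1$ vanishes by partial fractions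
(`exists_normalization_cousin`). The normalization sequence therefore presents $H^1(\mathcal{O})$ as
half-edge functions modulo vertex functions and values of global sections. Both end values on $e_0$
are free while those on any other edge coincide, so the quotient is $H^1(\Gamma\setminus
e_0;\mathbb{C})$ (`cochainClassEquiv`). A global function acts on it by its common node value
(`smul_structureSheaf_H1`).

Vector fields. Write a field as $u\,x\partial_x$. Its rotation numbers are $u(0)$ and $-u(\infty)$,
so balance is Kirchhoff's law for the end values of $u$ (`mem_balanced_iff`). For $H^1(\tilde T)=0$,
solve the Cousin problem for the coefficients, then remove the imbalance at the nodes by a global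
section: flows on $\Gamma\setminus e_0$ realize every divergence of total zero, and the independent
end values on $e_0$ absorb the total (`IsNonseparating.subsingleton_H1_balanced`). Globally, $u$ is
a polynomial $P(t)$ on $e_0$ and constant elsewhere; summing the balance condition over the vertices
gives $P(0)=P(1)$. After subtracting $P(0)$ times a fixed flow, $H^0(\tilde T)$ becomes $A$ times
the space of divergence-free flows on $\Gamma\setminus e_0$, with $A$ acting on the flows through
the node (`fieldHom`, `fieldHom_smul`).

Dimension. $H^1(\Gamma\setminus e_0)$ and the space of divergence-free flows both have dimension
$|E|-|V|$. Trivalence gives $2|E|=3|V|$, so together they have dimension $|V|=2g-2$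
(`finrank_H1_prod_flows`). -/

noncomputable section

/-! ### Values of rational functions at points of the projective line -/

/-- The valuation is discrete: no value lies strictly between $\exp(-1)$ and $1$. -/
theorem le_exp_neg_one_iff {x : WithZero (Multiplicative ℤ)} : x ≤ WithZero.exp (-1) ↔ x < 1 := by
  rw [← WithZero.lt_mul_exp_iff_le (by simp), ← WithZero.exp_add]
  simp

theorem pointVal_some_polynomial_le (z : ℂ) (P : Polynomial ℂ) :
    pointVal (OnePoint.some z) (algebraMap _ _ P) ≤ 1 :=
  (pointIdeal z).valuation_le_one P

theorem mem_pointIdeal {z : ℂ} {P : Polynomial ℂ} :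
    P ∈ (pointIdeal z).asIdeal ↔ P.eval z = 0 := by
  rw [pointIdeal, Ideal.mem_span_singleton, Polynomial.dvd_iff_isRoot, Polynomial.IsRoot]

theorem pointVal_some_polynomial_eq_one {z : ℂ} {P : Polynomial ℂ} (h : P.eval z ≠ 0) :
    pointVal (OnePoint.some z) (algebraMap _ _ P) = 1 :=
  (pointIdeal z).valuation_eq_one_iff_notMem.2 (mt mem_pointIdeal.1 h)

theorem pointVal_some_polynomial_lt {z : ℂ} {P : Polynomial ℂ} (h : P.eval z = 0) :
    pointVal (OnePoint.some z) (algebraMap _ _ P) < 1 :=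
  ((pointIdeal z).valuation_lt_one_iff_mem P).2 (mem_pointIdeal.2 h)

theorem pointVal_some_div_le {z : ℂ} {P Q : Polynomial ℂ} (h : Q.eval z ≠ 0) :
    pointVal (OnePoint.some z) (algebraMap _ (RatFunc ℂ) P / algebraMap _ _ Q) ≤ 1 := by
  rw [map_div₀, pointVal_some_polynomial_eq_one h, div_one]
  exact pointVal_some_polynomial_le z P

theorem pointVal_some_X_sub_C (z : ℂ) :
    pointVal (OnePoint.some z) (RatFunc.X - RatFunc.C z) = WithZero.exp (-1) := by
  have h := (pointIdeal z).intValuation_singleton (Polynomial.X_sub_C_ne_zero z) rfl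
  rw [← (pointIdeal z).valuation_of_algebraMap (K := RatFunc ℂ)] at h
  simpa [pointVal] using h

theorem eval_denom_ne_zero {z : ℂ} {f : RatFunc ℂ} (h : pointVal (OnePoint.some z) f ≤ 1) :
    f.denom.eval z ≠ 0 := by
  have key := (pointIdeal z).valuation_div_le_one_iff (RatFunc ℂ) f.num f.denom_ne_zero ?_
  · have h' : (pointIdeal z).valuation (RatFunc ℂ)
        (algebraMap _ _ f.num / algebraMap _ _ f.denom) ≤ 1 := by
      rw [RatFunc.num_div_denom]; exact h
    exact mt mem_pointIdeal.2 (key.1 h')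
  · intro h1 h2
    obtain ⟨a, b, hab⟩ := f.isCoprime_num_denom
    have := congrArg (Polynomial.eval z) hab
    simp [mem_pointIdeal.1 h1, mem_pointIdeal.1 h2] at this

theorem pointVal_infty_polynomial {P : Polynomial ℂ} (hP : P ≠ 0) :
    pointVal OnePoint.infty (algebraMap _ _ P) = WithZero.exp (P.natDegree : ℤ) := by
  classical
  rw [← RatFunc.inftyValuation.polynomial ℂ hP]
  change RatFunc.inftyValuationDef ℂ _ = _
  congr

theorem pointVal_infty_div_le {P Q : Polynomial ℂ} (hQ : Q ≠ 0) {n : ℤ}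
    (h : (P.natDegree : ℤ) ≤ Q.natDegree + n) :
    pointVal OnePoint.infty (algebraMap _ (RatFunc ℂ) P / algebraMap _ _ Q) ≤ WithZero.exp n := by
  rcases eq_or_ne P 0 with rfl | hP
  · simp
  · rw [map_div₀, pointVal_infty_polynomial hP, pointVal_infty_polynomial hQ, ← WithZero.exp_sub,
      WithZero.exp_le_exp]
    omega

theorem natDegree_num_le {f : RatFunc ℂ} (h : pointVal OnePoint.infty f ≤ 1) :
    f.num.natDegree ≤ f.denom.natDegree := by
  rcases eq_or_ne f 0 with rfl | hf
  · simp
  · rw [← RatFunc.num_div_denom f, map_div₀,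
      pointVal_infty_polynomial (RatFunc.num_ne_zero hf),
      pointVal_infty_polynomial f.denom_ne_zero, ← WithZero.exp_sub, ← WithZero.exp_zero,
      WithZero.exp_le_exp] at h
    omega

theorem hasValueAt_some_div {z : ℂ} {P Q : Polynomial ℂ} (h : Q.eval z ≠ 0) :
    HasValueAt (OnePoint.some z) (algebraMap _ (RatFunc ℂ) P / algebraMap _ _ Q)
      (P.eval z / Q.eval z) := by
  have hQ : algebraMap _ (RatFunc ℂ) Q ≠ 0 := by
    simpa using fun h0 : Q = 0 => h (by simp [h0])
  rw [HasValueAt, le_exp_neg_one_iff]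
  have : algebraMap _ (RatFunc ℂ) P / algebraMap _ _ Q - RatFunc.C (P.eval z / Q.eval z) =
      algebraMap _ _ (P - Polynomial.C (P.eval z / Q.eval z) * Q) / algebraMap _ _ Q := by
    rw [map_sub, map_mul, RatFunc.algebraMap_C]
    field_simp
  rw [this, map_div₀, pointVal_some_polynomial_eq_one h, div_one]
  exact pointVal_some_polynomial_lt (by simp; field_simp; ring)

/-- The residue field at every closed point is $\mathbb{C}$. At $\infty$ the value is the
coefficient of the numerator in the degree of the monic denominator; at a finite point it is the
quotient of the evaluations. -/
theorem exists_hasValueAt {p : OnePoint ℂ} {f : RatFunc ℂ} (h : pointVal p f ≤ 1) :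
    ∃ c, HasValueAt p f c := by
  rcases p with _ | z
  · refine ⟨f.num.coeff f.denom.natDegree, ?_⟩
    set n := f.denom.natDegree with hn
    have hd := f.denom_ne_zero
    have hQ : algebraMap _ (RatFunc ℂ) f.denom ≠ 0 := by simpa using hd
    change pointVal OnePoint.infty _ ≤ _
    have : f - RatFunc.C (f.num.coeff n) =
        algebraMap _ _ (f.num - Polynomial.C (f.num.coeff n) * f.denom) /
          algebraMap _ _ f.denom := by
      rw [map_sub, map_mul, RatFunc.algebraMap_C, sub_div, RatFunc.num_div_denom]
      field_simp
    rw [this]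
    set P := f.num - Polynomial.C (f.num.coeff n) * f.denom with hP
    rcases eq_or_ne P 0 with h0 | h0
    · rw [h0]; simp
    refine pointVal_infty_div_le hd ?_
    have h1 : P.natDegree ≤ n := by
      refine (Polynomial.natDegree_sub_le _ _).trans (max_le (natDegree_num_le h) ?_)
      exact Polynomial.natDegree_C_mul_le _ _
    -- The denominator is monic, so subtracting that multiple of it kills the coefficient of degree
    -- `n`; the strict drop in degree is the vanishing at $\infty$.
    have h2 : P.natDegree ≠ n := by
      intro h3
      have : P.coeff n = 0 := by
        have := f.monic_denom.coeff_natDegree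
        rw [← hn] at this
        simp [hP, this]
      rw [← h3] at this
      exact h0 (Polynomial.leadingCoeff_eq_zero.1 this)
    omega
  · have h1 := hasValueAt_some_div (P := f.num) (eval_denom_ne_zero h)
    rw [RatFunc.num_div_denom] at h1
    exact ⟨_, h1⟩

theorem pointVal_C {p : OnePoint ℂ} {c : ℂ} (hc : c ≠ 0) : pointVal p (RatFunc.C c) = 1 := by
  refine le_antisymm (pointVal_C_le p c) ?_
  have h := pointVal_C_le p c⁻¹
  rw [map_inv₀, map_inv₀] at h
  exact (inv_le_one₀ ((Valuation.pos_iff _).2 (by simpa using hc))).1 h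

theorem HasValueAt.neg {p : OnePoint ℂ} {f : RatFunc ℂ} {c : ℂ} (hf : HasValueAt p f c) :
    HasValueAt p (-f) (-c) := by
  simpa using (hasValueAt_C p (-1)).mul hf

theorem HasValueAt.sub {p : OnePoint ℂ} {f g : RatFunc ℂ} {c d : ℂ} (hf : HasValueAt p f c)
    (hg : HasValueAt p g d) : HasValueAt p (f - g) (c - d) := by
  simpa [sub_eq_add_neg] using hf.add hg.neg

theorem HasValueAt.unique {p : OnePoint ℂ} {f : RatFunc ℂ} {c d : ℂ} (hf : HasValueAt p f c)
    (hg : HasValueAt p f d) : c = d := by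
  by_contra h
  have h1 := hf.sub hg
  rw [HasValueAt, sub_self, zero_sub, Valuation.map_neg, pointVal_C (sub_ne_zero.2 h),
    le_exp_neg_one_iff] at h1
  exact lt_irrefl _ h1

/-- The value of a rational function at a point; it is zero if the function is not regular. -/
def valueAt (p : OnePoint ℂ) (f : RatFunc ℂ) : ℂ :=
  open Classical in if h : ∃ c, HasValueAt p f c then h.choose else 0

theorem HasValueAt.valueAt_eq {p : OnePoint ℂ} {f : RatFunc ℂ} {c : ℂ} (h : HasValueAt p f c) :
    valueAt p f = c := by
  have h' : ∃ c, HasValueAt p f c := ⟨c, h⟩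
  rw [valueAt, dif_pos h']
  exact h'.choose_spec.unique h

theorem hasValueAt_valueAt {p : OnePoint ℂ} {f : RatFunc ℂ} (h : pointVal p f ≤ 1) :
    HasValueAt p f (valueAt p f) := by
  obtain ⟨c, hc⟩ := exists_hasValueAt h
  rwa [hc.valueAt_eq]

/-! ### Partial fractions -/

/-- At $\infty$ the principal part is the polynomial quotient of numerator by denominator. At a
finite point it is the term of the partial fraction expansion whose denominator is a power of $x-z$.
-/
theorem exists_principal_part (p : OnePoint ℂ) (f : RatFunc ℂ) :
    ∃ a : RatFunc ℂ, (∀ p', p' ≠ p → pointVal p' a ≤ 1) ∧ pointVal p (a - f) ≤ 1 := by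
  rcases p with _ | z
  · refine ⟨algebraMap _ _ (f.num /ₘ f.denom), ?_, ?_⟩
    · rintro (_ | z) h
      · exact absurd rfl h
      · exact pointVal_some_polynomial_le z _
    · have hd := f.denom_ne_zero
      have hQ : algebraMap _ (RatFunc ℂ) f.denom ≠ 0 := by simpa using hd
      have : algebraMap _ _ (f.num /ₘ f.denom) - f =
          -(algebraMap _ _ (f.num %ₘ f.denom) / algebraMap _ _ f.denom) := by
        have h1 := congrArg (algebraMap _ (RatFunc ℂ)) (Polynomial.modByMonic_add_div f.num f.denom)
        rw [map_add, map_mul] at h1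
        have h2 : f = algebraMap _ _ f.num / algebraMap _ _ f.denom := (RatFunc.num_div_denom f).symm
        rw [← h1, eq_div_iff hQ] at h2
        field_simp
        linear_combination -h2
      rw [this, Valuation.map_neg, ← WithZero.exp_zero]
      refine pointVal_infty_div_le hd ?_
      have := Polynomial.natDegree_modByMonic_le f.num f.monic_denom
      omega
  · obtain ⟨R, hR, hz⟩ := Polynomial.exists_eq_pow_rootMultiplicity_mul_and_not_dvd f.denom
      f.denom_ne_zero z
    set n := f.denom.rootMultiplicity z
    have hz' : R.eval z ≠ 0 := fun h => hz (Polynomial.dvd_iff_isRoot.2 h)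
    have hm : ((Polynomial.X - Polynomial.C z) ^ n).Monic := (Polynomial.monic_X_sub_C z).pow n
    have hRm : R.Monic := by
      have := f.monic_denom
      rw [hR] at this
      exact hm.of_mul_monic_left this
    have hco : IsCoprime ((Polynomial.X - Polynomial.C z) ^ n) R :=
      ((Polynomial.irreducible_X_sub_C z).coprime_iff_not_dvd.2 hz).pow_left
    obtain ⟨s, r₁, r₂, h1, h2, h3⟩ :=
      Polynomial.div_eq_quo_add_rem_div_add_rem_div (RatFunc ℂ) f.num hm hRm hco
    have hf : f = algebraMap _ _ s +
        algebraMap _ _ r₁ / algebraMap _ _ ((Polynomial.X - Polynomial.C z) ^ n) +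
        algebraMap _ _ r₂ / algebraMap _ _ R := by
      refine Eq.trans ?_ h3
      conv_lhs => rw [← RatFunc.num_div_denom f, hR, map_mul]
    refine ⟨algebraMap _ _ r₁ / algebraMap _ _ ((Polynomial.X - Polynomial.C z) ^ n), ?_, ?_⟩
    · rintro (_ | w) h
      -- The numerator `r₁` has smaller degree than the denominator, so the term has no pole at
      -- $\infty$.
      · refine (pointVal_infty_div_le hm.ne_zero (n := 0) ?_).trans_eq WithZero.exp_zero
        have := Polynomial.natDegree_le_natDegree h1.le
        omega
      · refine pointVal_some_div_le ?_
        have : w ≠ z := fun h' => h (by rw [h'])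
        simpa [sub_eq_zero] using fun h' => absurd h' this
    · rw [← Valuation.map_neg]
      have : -(algebraMap _ (RatFunc ℂ) r₁ /
          algebraMap _ _ ((Polynomial.X - Polynomial.C z) ^ n) - f) =
          algebraMap _ _ s + algebraMap _ _ r₂ / algebraMap _ _ R := by
        rw [hf]; ring
      rw [this]
      exact Valuation.map_add_le _ (pointVal_some_polynomial_le z s) (pointVal_some_div_le hz')

/-- The additive Cousin problem on the projective line has a solution. -/
theorem exists_prescribed_principal_parts (h : OnePoint ℂ → RatFunc ℂ)
    (hfin : {p | ¬ pointVal p (h p) ≤ 1}.Finite) :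
    ∃ r : RatFunc ℂ, ∀ p, pointVal p (r - h p) ≤ 1 := by
  choose a ha ha' using fun p => exists_principal_part p (h p)
  classical
  refine ⟨∑ p ∈ hfin.toFinset, a p, fun p => ?_⟩
  by_cases hp : p ∈ hfin.toFinset
  · rw [← Finset.add_sum_erase _ _ hp, add_sub_right_comm]
    refine Valuation.map_add_le _ (ha' p) (Valuation.map_sum_le _ fun i hi => ha i p ?_)
    exact (Finset.ne_of_mem_erase hi).symm
  · refine Valuation.map_sub_le _ (Valuation.map_sum_le _ fun i hi => ha i p ?_) ?_
    · rintro rfl; exact hp hi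
    · simpa using hp

/-! ### Functions with at most one pole -/

/-- The coordinate `x / (x - q)`, which takes the values `0`, `1`, `∞` at `0`, `∞`, `q`. -/
def affineCoord (q : ℂˣ) : RatFunc ℂ := RatFunc.X / (RatFunc.X - RatFunc.C (q : ℂ))

theorem X_sub_C_ne_zero (z : ℂ) : (RatFunc.X - RatFunc.C z : RatFunc ℂ) ≠ 0 := by
  have := (Valuation.ne_zero_iff (pointVal (OnePoint.some z))
    (x := RatFunc.X - RatFunc.C z)).1 (by rw [pointVal_some_X_sub_C]; simp)
  exact this

theorem hasValueAt_affineCoord_some {q : ℂˣ} {z : ℂ} (hz : z ≠ q) :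
    HasValueAt (OnePoint.some z) (affineCoord q) (z / (z - q)) := by
  have := hasValueAt_some_div (z := z) (P := Polynomial.X)
    (Q := Polynomial.X - Polynomial.C (q : ℂ)) (by simpa [sub_eq_zero] using hz)
  simpa [affineCoord] using this

theorem hasValueAt_affineCoord_infty (q : ℂˣ) :
    HasValueAt OnePoint.infty (affineCoord q) 1 := by
  have : affineCoord q - RatFunc.C 1 = algebraMap _ _ (Polynomial.C (q : ℂ)) /
      algebraMap _ _ (Polynomial.X - Polynomial.C (q : ℂ)) := by
    have := X_sub_C_ne_zero (q : ℂ)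
    simp [affineCoord]
    field_simp
    ring
  rw [HasValueAt, this]
  exact pointVal_infty_div_le (Polynomial.X_sub_C_ne_zero _) (by simp)

theorem HasValueAt.aeval {p : OnePoint ℂ} {f : RatFunc ℂ} {c : ℂ} (hf : HasValueAt p f c)
    (P : Polynomial ℂ) : HasValueAt p (Polynomial.aeval f P) (P.eval c) := by
  induction P using Polynomial.induction_on with
  | C a => simpa [RatFunc.algebraMap_eq_C] using hasValueAt_C p a
  | add P Q hP hQ => simpa using hP.add hQ
  | monomial n a h =>
    have := h.mul hf
    simpa [pow_succ, mul_assoc] using this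

theorem hasValueAt_aeval_zero (q : ℂˣ) (P : Polynomial ℂ) :
    HasValueAt (OnePoint.some 0) (Polynomial.aeval (affineCoord q) P) (P.eval 0) := by
  have := hasValueAt_affineCoord_some (q := q) q.ne_zero.symm
  rw [zero_div] at this
  exact this.aeval P

theorem hasValueAt_aeval_infty (q : ℂˣ) (P : Polynomial ℂ) :
    HasValueAt OnePoint.infty (Polynomial.aeval (affineCoord q) P) (P.eval 1) :=
  (hasValueAt_affineCoord_infty q).aeval P

theorem pointVal_aeval_le {q : ℂˣ} {p : OnePoint ℂ} (hp : p ≠ OnePoint.some (q : ℂ))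
    (P : Polynomial ℂ) : pointVal p (Polynomial.aeval (affineCoord q) P) ≤ 1 := by
  rcases p with _ | z
  · exact (hasValueAt_aeval_infty q P).regular
  · have : z ≠ q := fun h => hp (by rw [← h]; rfl)
    exact ((hasValueAt_affineCoord_some this).aeval P).regular

/-- The coordinate takes every value $c\ne 1$ at the finite point $cq/(c-1)$, so a polynomial killed
by the substitution has infinitely many roots. -/
theorem aeval_affineCoord_injective (q : ℂˣ) :
    Function.Injective (Polynomial.aeval (R := ℂ) (affineCoord q)) := by
  rw [injective_iff_map_eq_zero]
  intro P hP
  refine Polynomial.eq_zero_of_infinite_isRoot P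
    ((Set.finite_singleton (1 : ℂ)).infinite_compl.mono fun c hc => ?_)
  have hc' : c - 1 ≠ 0 := sub_ne_zero.2 hc
  have hq := q.ne_zero
  have h1 : c * q / (c - 1) ≠ q := by
    rw [ne_eq, div_eq_iff hc', mul_comm, mul_right_inj' hq]
    intro h
    have : (1 : ℂ) = 0 := by linear_combination h
    exact one_ne_zero this
  have h2 : c * q / (c - 1) / (c * q / (c - 1) - q) = c := by
    have h3 : c * q - q * (c - 1) ≠ 0 := by ring_nf; exact hq
    field_simp
    ring
  have h := (hasValueAt_affineCoord_some h1).aeval P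
  rw [h2, hP] at h
  have h0 := hasValueAt_C (OnePoint.some (c * q / (c - 1))) 0
  rw [map_zero] at h0
  exact h.unique h0

/-- A pole only at $q$ forces the denominator $(x-q)^n$, and regularity at $\infty$ bounds the
degree of the numerator by $n$. Then $f$ is a combination of the products $t^k(x-q)^{-(n-k)}$, and
$1/(x-q)=q^{-1}(t-1)$ is itself a polynomial in $t$. -/
theorem exists_aeval_eq {q : ℂˣ} {f : RatFunc ℂ}
    (h : ∀ p, p ≠ OnePoint.some (q : ℂ) → pointVal p f ≤ 1) :
    ∃ P : Polynomial ℂ, Polynomial.aeval (affineCoord q) P = f := by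
  obtain ⟨R, hR, hz⟩ := Polynomial.exists_eq_pow_rootMultiplicity_mul_and_not_dvd f.denom
    f.denom_ne_zero (q : ℂ)
  set n := f.denom.rootMultiplicity (q : ℂ)
  have hm : ((Polynomial.X - Polynomial.C (q : ℂ)) ^ n).Monic :=
    (Polynomial.monic_X_sub_C (q : ℂ)).pow n
  have hRm : R.Monic := by
    have := f.monic_denom
    rw [hR] at this
    exact hm.of_mul_monic_left this
  have hR1 : R = 1 := by
    refine hRm.natDegree_eq_zero.1 ?_
    by_contra hdeg
    obtain ⟨z, hz'⟩ := IsAlgClosed.exists_root R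
      (fun h' => hdeg (Polynomial.natDegree_eq_of_degree_eq_some h'))
    by_cases hzq : z = q
    · subst hzq; exact hz (Polynomial.dvd_iff_isRoot.2 hz')
    · refine eval_denom_ne_zero (h (OnePoint.some z) (by simpa using hzq)) ?_
      rw [hR, Polynomial.eval_mul, hz'.eq_zero, mul_zero]
  rw [hR1, mul_one] at hR
  have hdeg := natDegree_num_le (h OnePoint.infty (by simp))
  rw [hR, Polynomial.natDegree_pow, Polynomial.natDegree_X_sub_C, mul_one] at hdeg
  have hX := X_sub_C_ne_zero (q : ℂ)
  have hq : RatFunc.C (q : ℂ) ≠ 0 := by simp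
  suffices f ∈ (Polynomial.aeval (R := ℂ) (affineCoord q)).range from this
  have ht : affineCoord q ∈ (Polynomial.aeval (R := ℂ) (affineCoord q)).range :=
    ⟨Polynomial.X, by simp⟩
  have hinv : (RatFunc.X - RatFunc.C (q : ℂ))⁻¹ ∈
      (Polynomial.aeval (R := ℂ) (affineCoord q)).range := by
    have : (RatFunc.X - RatFunc.C (q : ℂ))⁻¹ = (q : ℂ)⁻¹ • (affineCoord q - 1) := by
      rw [RatFunc.smul_eq_C_mul, affineCoord, map_inv₀]
      field_simp
      ring
    rw [this]
    exact Subalgebra.smul_mem _ (Subalgebra.sub_mem _ ht (Subalgebra.one_mem _)) _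
  have hf : f = ∑ k ∈ Finset.range (n + 1), f.num.coeff k •
      (affineCoord q ^ k * (RatFunc.X - RatFunc.C (q : ℂ))⁻¹ ^ (n - k)) := by
    conv_lhs => rw [← RatFunc.num_div_denom f, hR,
      Polynomial.as_sum_range' f.num (n + 1) (Nat.lt_succ_of_le hdeg)]
    rw [map_sum, Finset.sum_div]
    refine Finset.sum_congr rfl fun k hk => ?_
    have hk' : k ≤ n := Nat.lt_succ_iff.1 (Finset.mem_range.1 hk)
    rw [RatFunc.algebraMap_monomial, RatFunc.smul_eq_C_mul, affineCoord, map_pow, map_sub,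
      RatFunc.algebraMap_X, RatFunc.algebraMap_C, div_pow, inv_pow, div_mul_eq_mul_div,
      ← div_eq_mul_inv, div_div, ← pow_add, Nat.sub_add_cancel hk', mul_div_assoc]
  rw [hf]
  exact Subalgebra.sum_mem _ fun k _ => Subalgebra.smul_mem _
    (Subalgebra.mul_mem _ (Subalgebra.pow_mem _ ht _) (Subalgebra.pow_mem _ hinv _)) _

theorem exists_eq_C {f : RatFunc ℂ} (h : ∀ p, pointVal p f ≤ 1) : ∃ c, f = RatFunc.C c := by
  have hden : f.denom = 1 := by
    refine f.monic_denom.natDegree_eq_zero.1 ?_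
    by_contra hdeg
    obtain ⟨z, hz⟩ := IsAlgClosed.exists_root f.denom
      (fun h' => hdeg (Polynomial.natDegree_eq_of_degree_eq_some h'))
    exact eval_denom_ne_zero (h (OnePoint.some z)) hz
  have hnum := natDegree_num_le (h OnePoint.infty)
  rw [hden, Polynomial.natDegree_one, Nat.le_zero] at hnum
  refine ⟨f.num.coeff 0, ?_⟩
  conv_lhs => rw [← RatFunc.num_div_denom f, hden, Polynomial.eq_C_of_natDegree_eq_zero hnum]
  simp


/-! ### Rational vector fields on the projective line -/

/-- A dual number is invertible as soon as its body is. This lets the map from polynomials extend to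
fractions, and so yields the derivation $x\partial_x$ with no explicit quotient rule. -/
theorem eulerHom_isUnit (y : nonZeroDivisors (Polynomial ℂ)) :
    IsUnit (Polynomial.aeval (TrivSqZeroExt.inl RatFunc.X + TrivSqZeroExt.inr RatFunc.X :
      TrivSqZeroExt (RatFunc ℂ) (RatFunc ℂ)) y.1) := by
  rw [TrivSqZeroExt.isUnit_iff_isUnit_fst, isUnit_iff_ne_zero]
  have h : TrivSqZeroExt.fst (Polynomial.aeval (TrivSqZeroExt.inl RatFunc.X +
      TrivSqZeroExt.inr RatFunc.X : TrivSqZeroExt (RatFunc ℂ) (RatFunc ℂ)) y.1) =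
      algebraMap _ _ y.1 := by
    rw [← TrivSqZeroExt.fstHom_apply ℂ, ← Polynomial.aeval_algHom_apply]
    simp [RatFunc.aeval_X_left_eq_algebraMap]
  rw [h]
  simp

/-- The homomorphism `f ↦ f + x f' ε` into the dual numbers over `ℂ(x)`. -/
def eulerHom : RatFunc ℂ →ₐ[ℂ] TrivSqZeroExt (RatFunc ℂ) (RatFunc ℂ) :=
  IsLocalization.liftAlgHom (M := nonZeroDivisors (Polynomial ℂ))
    (f := Polynomial.aeval (TrivSqZeroExt.inl RatFunc.X + TrivSqZeroExt.inr RatFunc.X :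
      TrivSqZeroExt (RatFunc ℂ) (RatFunc ℂ))) eulerHom_isUnit

theorem eulerHom_X : eulerHom RatFunc.X =
    TrivSqZeroExt.inl RatFunc.X + TrivSqZeroExt.inr RatFunc.X := by
  have h := IsLocalization.lift_eq (M := nonZeroDivisors (Polynomial ℂ)) (S := RatFunc ℂ)
    (g := (Polynomial.aeval (R := ℂ) (TrivSqZeroExt.inl RatFunc.X + TrivSqZeroExt.inr RatFunc.X :
      TrivSqZeroExt (RatFunc ℂ) (RatFunc ℂ))).toRingHom) eulerHom_isUnit Polynomial.X
  rw [RatFunc.algebraMap_X] at h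
  refine Eq.trans h ?_
  exact Polynomial.aeval_X _

theorem eulerHom_fst (f : RatFunc ℂ) : (eulerHom f).fst = f := by
  have : ((TrivSqZeroExt.fstHom ℂ (RatFunc ℂ) (RatFunc ℂ)).comp eulerHom) =
      AlgHom.id ℂ (RatFunc ℂ) := by
    refine IsLocalization.algHom_ext (nonZeroDivisors (Polynomial ℂ)) ?_
    ext
    change (eulerHom (algebraMap (Polynomial ℂ) _ Polynomial.X)).fst =
      algebraMap (Polynomial ℂ) _ Polynomial.X
    rw [RatFunc.algebraMap_X, eulerHom_X]
    simp
  exact DFunLike.congr_fun this f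

/-- The vector field `x ∂_x`. -/
def eulerField : RatVec :=
  Derivation.mk' ((TrivSqZeroExt.sndHom (RatFunc ℂ) (RatFunc ℂ)).restrictScalars ℂ ∘ₗ
    eulerHom.toLinearMap) fun a b => by
      simp [eulerHom_fst, mul_comm]

theorem eulerField_X : eulerField RatFunc.X = RatFunc.X := by
  simp [eulerField, eulerHom_X]

theorem ratVec_polynomial (D : RatVec) (P : Polynomial ℂ) :
    D (algebraMap _ _ P) = algebraMap _ _ (Polynomial.derivative P) * D RatFunc.X := by
  rw [← RatFunc.aeval_X_left_eq_algebraMap, ← RatFunc.aeval_X_left_eq_algebraMap,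
    Derivation.map_aeval, smul_eq_mul]

theorem ratVec_div (D : RatVec) (P Q : Polynomial ℂ) :
    D (algebraMap _ _ P / algebraMap _ _ Q) =
      algebraMap _ _ (Q * Polynomial.derivative P - P * Polynomial.derivative Q) /
        algebraMap _ _ (Q ^ 2) * D RatFunc.X := by
  rw [Derivation.leibniz_div, ratVec_polynomial, ratVec_polynomial]
  simp only [smul_eq_mul, map_sub, map_mul, map_pow]
  ring

/-- A rational vector field is a multiple of `x ∂_x`. -/
def vecCoeff : RatVec ≃ₗ[RatFunc ℂ] RatFunc ℂ where
  toFun D := RatFunc.X⁻¹ * D RatFunc.X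
  map_add' D D' := by simp [mul_add]
  map_smul' f D := by simp; ring
  invFun u := u • eulerField
  left_inv D := by
    ext f
    rw [← RatFunc.num_div_denom f]
    have := RatFunc.X_ne_zero (K := ℂ)
    rw [Derivation.smul_apply, ratVec_div, ratVec_div, eulerField_X, smul_eq_mul]
    field_simp
  right_inv u := by
    have := RatFunc.X_ne_zero (K := ℂ)
    change RatFunc.X⁻¹ * (u • eulerField) RatFunc.X = u
    rw [Derivation.smul_apply, eulerField_X, smul_eq_mul]
    field_simp

theorem vecCoeff_smul_eulerField (D : RatVec) : vecCoeff D • eulerField = D :=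
  vecCoeff.left_inv D

theorem apply_X_eq (D : RatVec) : D RatFunc.X = vecCoeff D * RatFunc.X := by
  conv_lhs => rw [← vecCoeff_smul_eulerField D]
  rw [Derivation.smul_apply, eulerField_X, smul_eq_mul]

/-- By the quotient rule $f'$ has the squared denominator of $f$, hence no pole where $f$ has none.
-/
theorem exists_eulerField_eq (f : RatFunc ℂ) (z : ℂ) (h : pointVal (OnePoint.some z) f ≤ 1) :
    ∃ g, pointVal (OnePoint.some z) g ≤ 1 ∧ eulerField f = g * RatFunc.X := by
  refine ⟨_, ?_, by
    conv_lhs => rw [← RatFunc.num_div_denom f]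
    rw [ratVec_div, eulerField_X]⟩
  exact pointVal_some_div_le (by simpa using eval_denom_ne_zero h)

theorem pointVal_X_some {z : ℂ} (hz : z ≠ 0) : pointVal (OnePoint.some z) RatFunc.X = 1 := by
  rw [← RatFunc.algebraMap_X]
  exact pointVal_some_polynomial_eq_one (by simpa using hz)

theorem pointVal_X_zero : pointVal (OnePoint.some 0) RatFunc.X = WithZero.exp (-1) := by
  simpa using pointVal_some_X_sub_C 0

theorem pointVal_X_infty : pointVal OnePoint.infty RatFunc.X = WithZero.exp 1 := by
  rw [← RatFunc.algebraMap_X, pointVal_infty_polynomial Polynomial.X_ne_zero,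
    Polynomial.natDegree_X]
  rfl

/-- Away from $0$ and $\infty$ the coordinate $x$ is a unit, so $x\partial_x$ generates the regular
fields; the converse is tested on $x$ itself. -/
theorem vecRegularAt_iff {z : ℂ} (hz : z ≠ 0) (D : RatVec) :
    VecRegularAt (OnePoint.some z) D ↔ pointVal (OnePoint.some z) (vecCoeff D) ≤ 1 := by
  constructor
  · intro h
    have := h RatFunc.X (pointVal_X_some hz).le
    rwa [apply_X_eq, map_mul, pointVal_X_some hz, mul_one] at this
  · intro h
    rw [← vecCoeff_smul_eulerField D]
    refine VecRegularAt.smul h fun f hf => ?_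
    obtain ⟨g, hg, hfg⟩ := exists_eulerField_eq f z hf
    rwa [hfg, map_mul, pointVal_X_some hz, mul_one]

theorem hasRotationAt_zero_eulerField : HasRotationAt (OnePoint.some 0) eulerField 1 := by
  have key : ∀ f : RatFunc ℂ, pointVal (OnePoint.some 0) f ≤ WithZero.exp (-1) →
      pointVal (OnePoint.some 0) (eulerField f - RatFunc.C 1 * f) ≤ WithZero.exp (-2) := by
    intro f hf
    have hX := RatFunc.X_ne_zero (K := ℂ)
    have hh : pointVal (OnePoint.some 0) (RatFunc.X⁻¹ * f) ≤ 1 := by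
      rw [map_mul, map_inv₀, pointVal_X_zero, ← WithZero.exp_neg, ← WithZero.exp_zero]
      refine (mul_le_mul_right hf _).trans_eq ?_
      rw [← WithZero.exp_add]; rfl
    obtain ⟨g, hg, hfg⟩ := exists_eulerField_eq _ 0 hh
    -- Writing $f=xh$ with $h$ regular, the Leibniz rule leaves $x\cdot x\partial_x h$, which is
    -- divisible by $x^2$.
    have : eulerField f - RatFunc.C 1 * f = g * RatFunc.X * RatFunc.X := by
      conv_lhs => rw [← mul_inv_cancel_left₀ hX f]
      rw [Derivation.leibniz, hfg, eulerField_X]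
      simp
      ring
    rw [this, map_mul, map_mul, pointVal_X_zero, mul_assoc, ← WithZero.exp_add]
    exact (mul_le_mul_left hg _).trans_eq (one_mul _)
  refine fun f hf => ⟨?_, key f hf⟩
  have h := (pointVal (OnePoint.some 0)).map_add_le
    ((key f hf).trans (WithZero.exp_le_exp.2 (by norm_num : (-2 : ℤ) ≤ -1))) hf
  simpa using h

/-- The numerator $QP'-PQ'$ has degree below $\deg P+\deg Q$; the factor $x$ restores the lost
degree and no more. -/
theorem pointVal_infty_eulerField_le (f : RatFunc ℂ) :
    pointVal OnePoint.infty (eulerField f) ≤ pointVal OnePoint.infty f := by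
  rcases eq_or_ne f 0 with rfl | hf
  · simp
  have hd := f.denom_ne_zero
  have hn := RatFunc.num_ne_zero hf
  have hX : algebraMap (Polynomial ℂ) (RatFunc ℂ) Polynomial.X = RatFunc.X := RatFunc.algebraMap_X
  rw [← RatFunc.num_div_denom f, ratVec_div, eulerField_X, ← hX, div_mul_eq_mul_div, ← map_mul,
    map_div₀ _ (algebraMap _ (RatFunc ℂ) f.num), pointVal_infty_polynomial hn,
    pointVal_infty_polynomial hd, ← WithZero.exp_sub]
  refine pointVal_infty_div_le (pow_ne_zero 2 hd) ?_
  rw [Polynomial.natDegree_pow]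
  set P := f.num
  set Q := f.denom
  by_cases h0 : Q * Polynomial.derivative P - P * Polynomial.derivative Q = 0
  · rw [h0]; simp; omega
  have h1 : (Q * Polynomial.derivative P - P * Polynomial.derivative Q).natDegree + 1 ≤
      P.natDegree + Q.natDegree := by
    have h2 : (Q * Polynomial.derivative P - P * Polynomial.derivative Q).degree <
        (P.natDegree + Q.natDegree : ℕ) := by
      have e : ((P.natDegree + Q.natDegree : ℕ) : WithBot ℕ) = P.degree + Q.degree := by
        rw [Polynomial.degree_eq_natDegree hn, Polynomial.degree_eq_natDegree hd]; rfl
      rw [e]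
      refine (Polynomial.degree_sub_le _ _).trans_lt (max_lt ?_ ?_)
      · rw [Polynomial.degree_mul, add_comm]
        exact WithBot.add_lt_add_right (by simpa using hd) (Polynomial.degree_derivative_lt hn)
      · rw [Polynomial.degree_mul]
        exact WithBot.add_lt_add_left (by simpa using hn) (Polynomial.degree_derivative_lt hd)
    have := (Polynomial.natDegree_lt_iff_degree_lt h0).2 h2
    omega
  rw [Polynomial.natDegree_mul h0 Polynomial.X_ne_zero, Polynomial.natDegree_X]
  push_cast
  omega

theorem hasRotationAt_infty_eulerField : HasRotationAt OnePoint.infty eulerField (-1) := by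
  intro f hf
  refine ⟨(pointVal_infty_eulerField_le f).trans hf, ?_⟩
  have hX := RatFunc.X_ne_zero (K := ℂ)
  have hh : pointVal OnePoint.infty (RatFunc.X * f) ≤ 1 := by
    rw [map_mul, pointVal_X_infty, ← WithZero.exp_zero]
    refine (mul_le_mul_right hf _).trans_eq ?_
    rw [← WithZero.exp_add]; rfl
  obtain ⟨c, hc⟩ := exists_hasValueAt hh
  have h1 : eulerField (RatFunc.X * f) = eulerField (RatFunc.X * f - RatFunc.C c) := by
    have : eulerField (RatFunc.C c) = 0 := eulerField.map_algebraMap c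
    rw [map_sub, this, sub_zero]
  -- Replacing $xf$ by $xf-c$ does not change its derivative but makes it vanish at $\infty$; the
  -- factor $x^{-1}$ supplies the second order of vanishing.
  have h2 : eulerField f - RatFunc.C (-1) * f =
      RatFunc.X⁻¹ * eulerField (RatFunc.X * f - RatFunc.C c) := by
    rw [← h1, Derivation.leibniz, eulerField_X]
    simp
    field_simp
  rw [h2, map_mul, map_inv₀, pointVal_X_infty, ← WithZero.exp_neg]
  refine (mul_le_mul_right ((pointVal_infty_eulerField_le _).trans hc) _).trans_eq ?_
  rw [← WithZero.exp_add]; rfl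

/-- The rotation number of `x ∂_x` at an end of a component. -/
def endSign : Bool → ℂ
  | false => 1
  | true => -1

theorem endSign_mul_self (b : Bool) : endSign b * endSign b = 1 := by
  cases b <;> simp [endSign]

/-- The rotation number is read off on the local coordinate, $x$ at $0$ and $x^{-1}$ at $\infty$,
after dividing by it. Conversely the field is a function times $x\partial_x$, and rotation numbers
scale by the value of the function. -/
theorem hasRotationAt_endPoint_iff (b : Bool) (D : RatVec) (ρ : ℂ) :
    HasRotationAt (endPoint b) D ρ ↔ HasValueAt (endPoint b) (vecCoeff D) (endSign b * ρ) := by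
  have hX := RatFunc.X_ne_zero (K := ℂ)
  constructor
  · intro h
    cases b
    · have h1 := (h RatFunc.X pointVal_X_zero.le).2
      rw [apply_X_eq, ← sub_mul, map_mul] at h1
      simp only [endPoint, endSign, one_mul] at h1 ⊢
      rw [pointVal_X_zero] at h1
      have h2 := mul_le_mul_left h1 (WithZero.exp (1 : ℤ))
      rw [mul_assoc, ← WithZero.exp_add, ← WithZero.exp_add] at h2
      simpa [HasValueAt] using h2
    · have hv : pointVal OnePoint.infty (RatFunc.X⁻¹) = WithZero.exp (-1) := by
        rw [map_inv₀, pointVal_X_infty]; rfl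
      have h1 := (h RatFunc.X⁻¹ hv.le).2
      have h0 : D RatFunc.X⁻¹ - RatFunc.C ρ * RatFunc.X⁻¹ =
          -((vecCoeff D - RatFunc.C (-ρ)) * RatFunc.X⁻¹) := by
        rw [Derivation.leibniz_inv, apply_X_eq, smul_eq_mul, map_neg]
        field_simp
        ring
      simp only [endPoint, endSign, neg_one_mul] at h1 ⊢
      rw [h0, Valuation.map_neg, map_mul, hv] at h1
      have h2 := mul_le_mul_left h1 (WithZero.exp (1 : ℤ))
      rw [mul_assoc, ← WithZero.exp_add, ← WithZero.exp_add] at h2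
      simpa [HasValueAt] using h2
  · intro h
    have key : HasRotationAt (endPoint b) eulerField (endSign b) := by
      cases b
      · exact hasRotationAt_zero_eulerField
      · exact hasRotationAt_infty_eulerField
    have := HasRotationAt.smul h key
    rwa [vecCoeff_smul_eulerField, mul_right_comm, endSign_mul_self, one_mul] at this


/-! ### First cohomology of abelian sheaves on a topological space -/

namespace SheafCohomology

variable {X : TopCat.{0}}
  {S : ShortComplex (CategoryTheory.Sheaf (Opens.grothendieckTopology X) AddCommGrpCat.{0})}

/-- The connecting homomorphism from global sections to `H¹`. -/
def connecting (hS : S.ShortExact) :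
    S.X₃.obj.obj (op (⊤ : Opens X)) →+ CategoryTheory.Sheaf.H.{0} S.X₁ 1 :=
  (hS.extClass.postcomp _ (zero_add 1)).comp
    (CategoryTheory.Sheaf.H.equiv₀ S.X₃ Limits.isTerminalTop).symm.toAddMonoidHom

theorem connecting_apply (hS : S.ShortExact) (y : S.X₃.obj.obj (op (⊤ : Opens X))) :
    connecting hS y = ((CategoryTheory.Sheaf.H.equiv₀ S.X₃ Limits.isTerminalTop).symm y).comp
      hS.extClass (zero_add 1) := rfl

theorem connecting_surjective (hS : S.ShortExact)
    [Subsingleton (CategoryTheory.Sheaf.H.{0} S.X₂ 1)] :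
    Function.Surjective (connecting hS) := by
  intro x
  obtain ⟨y, hy⟩ := Abelian.Ext.covariant_sequence_exact₁ _ hS x
    (Subsingleton.elim (α := CategoryTheory.Sheaf.H.{0} S.X₂ 1) _ _) (zero_add 1)
  refine ⟨CategoryTheory.Sheaf.H.equiv₀ S.X₃ Limits.isTerminalTop y, ?_⟩
  rw [connecting_apply, AddEquiv.symm_apply_apply, hy]

theorem connecting_eq_zero_iff (hS : S.ShortExact) (y : S.X₃.obj.obj (op (⊤ : Opens X))) :
    connecting hS y = 0 ↔ ∃ b : S.X₂.obj.obj (op (⊤ : Opens X)), S.g.hom.app (op ⊤) b = y := by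
  constructor
  · intro h
    obtain ⟨x, hx⟩ := Abelian.Ext.covariant_sequence_exact₃ _ hS _ (zero_add 1) h
    refine ⟨CategoryTheory.Sheaf.H.equiv₀ S.X₂ Limits.isTerminalTop x, ?_⟩
    rw [CategoryTheory.Sheaf.H.equiv₀_naturality, CategoryTheory.Sheaf.H.map_apply, hx]
    exact AddEquiv.apply_symm_apply _ y
  · rintro ⟨b, rfl⟩
    rw [connecting_apply, ← CategoryTheory.Sheaf.H.equiv₀_symm_naturality,
      CategoryTheory.Sheaf.H.map_apply, Abelian.Ext.comp_assoc_of_second_deg_zero,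
      hS.comp_extClass, Abelian.Ext.comp_zero]

/-- The action of functions on $H^1$ is defined by functoriality; this naturality makes it
computable on representatives in the quotient sheaf. -/
theorem map_connecting (hS : S.ShortExact) (f : S ⟶ S) (y : S.X₃.obj.obj (op (⊤ : Opens X))) :
    CategoryTheory.Sheaf.H.map f.τ₁ 1 (connecting hS y) =
      connecting hS (f.τ₃.hom.app (op ⊤) y) := by
  rw [connecting_apply, connecting_apply, ← CategoryTheory.Sheaf.H.equiv₀_symm_naturality,
    CategoryTheory.Sheaf.H.map_apply, CategoryTheory.Sheaf.H.map_apply,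
    Abelian.Ext.comp_assoc_of_second_deg_zero, ← hS.extClass_naturality hS f,
    Abelian.Ext.comp_assoc_of_third_deg_zero]

variable (F : CategoryTheory.Sheaf (Opens.grothendieckTopology X) AddCommGrpCat.{0})

/-- If every Čech `1`-cocycle of `F` on a cover indexed by the points is a coboundary, then
`H¹(F) = 0`. -/
theorem subsingleton_H_one
    (hF : ∀ (U : X → Opens X) (_ : ∀ x, x ∈ U x) (t : ∀ x y, F.obj.obj (op (U x ⊓ U y))),
      (∀ x y z, F.obj.map (homOfLE (inf_le_left : U x ⊓ U y ⊓ U z ≤ U x ⊓ U y)).op (t x y) +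
        F.obj.map (homOfLE (inf_le_inf_right _ inf_le_right :
          U x ⊓ U y ⊓ U z ≤ U y ⊓ U z)).op (t y z) =
        F.obj.map (homOfLE (inf_le_inf_right _ inf_le_left :
          U x ⊓ U y ⊓ U z ≤ U x ⊓ U z)).op (t x z)) →
      ∃ r : ∀ x, F.obj.obj (op (U x)), ∀ x y,
        t x y = F.obj.map (homOfLE (inf_le_left : U x ⊓ U y ≤ U x)).op (r x) -
          F.obj.map (homOfLE (inf_le_right : U x ⊓ U y ≤ U y)).op (r y)) :
    Subsingleton (CategoryTheory.Sheaf.H.{0} F 1) := by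
  let S : ShortComplex (CategoryTheory.Sheaf (Opens.grothendieckTopology X) AddCommGrpCat.{0}) :=
    ShortComplex.mk (Injective.ι F) (Limits.cokernel.π (Injective.ι F)) (by simp)
  have hS : S.ShortExact :=
    { exact := ShortComplex.exact_cokernel _
      mono_f := inferInstanceAs (Mono (Injective.ι F))
      epi_g := inferInstanceAs (Epi (Limits.cokernel.π (Injective.ι F))) }
  have hinj : Injective S.X₂ := inferInstanceAs (Injective (Injective.under F))
  -- Injectivity of the middle term kills its $H^1$, so every class comes from a global section of
  -- the cokernel, and it vanishes once that section lifts.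
  suffices h : ∀ c : S.X₃.obj.obj (op (⊤ : Opens X)), ∃ b, S.g.hom.app (op ⊤) b = c by
    refine subsingleton_of_forall_eq 0 fun x => ?_
    obtain ⟨y, rfl⟩ := connecting_surjective hS x
    exact (connecting_eq_zero_iff hS y).2 (h y)
  intro c
  have hloc := (TopCat.Presheaf.isLocallySurjective_iff S.g.hom).1
    ((TopCat.Sheaf.isLocallySurjective_iff_epi S.g).2 hS.epi_g) ⊤ c
  choose U hUtop hb hU using fun x => hloc x trivial
  choose b hb using hb
  have nat : ∀ {V W : Opens X} (i : op V ⟶ op W) (s : S.X₂.obj.obj (op V)),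
      S.g.hom.app (op W) (S.X₂.obj.map i s) = S.X₃.obj.map i (S.g.hom.app (op V) s) :=
    fun i s => NatTrans.naturality_apply S.g.hom i s
  have natf : ∀ {V W : Opens X} (i : op V ⟶ op W) (s : S.X₁.obj.obj (op V)),
      S.f.hom.app (op W) (S.X₁.obj.map i s) = S.X₂.obj.map i (S.f.hom.app (op V) s) :=
    fun i s => NatTrans.naturality_apply S.f.hom i s
  have hb' : ∀ x, S.g.hom.app (op (U x)) (b x) = S.X₃.obj.map (homOfLE (hUtop x)).op c := hb
  have comp₂ : ∀ {V W Z : Opens X} (i : op V ⟶ op W) (j : op W ⟶ op Z) (k : op V ⟶ op Z)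
      (s : S.X₂.obj.obj (op V)), S.X₂.obj.map j (S.X₂.obj.map i s) = S.X₂.obj.map k s := by
    intro V W Z i j k s
    rw [← ConcreteCategory.comp_apply, ← Functor.map_comp]
    rfl
  have comp₃ : ∀ {V W Z : Opens X} (i : op V ⟶ op W) (j : op W ⟶ op Z) (k : op V ⟶ op Z)
      (s : S.X₃.obj.obj (op V)), S.X₃.obj.map j (S.X₃.obj.map i s) = S.X₃.obj.map k s := by
    intro V W Z i j k s
    rw [← ConcreteCategory.comp_apply, ← Functor.map_comp]
    rfl
  have finj : ∀ V : Opens X, Function.Injective (S.f.hom.app (op V)) := by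
    intro V
    have h1 : Mono S.f.hom := by
      have := hS.mono_f
      exact inferInstanceAs (Mono ((sheafToPresheaf _ _).map S.f))
    have h2 : Mono (S.f.hom.app (op V)) := inferInstance
    exact (AddCommGrpCat.mono_iff_injective _).1 h2
  -- Two local lifts of the same section differ by a section of `F`; these differences form the
  -- cocycle to be split.
  have hex : ∀ x y, ∃ t : S.X₁.obj.obj (op (U x ⊓ U y)), S.f.hom.app (op (U x ⊓ U y)) t =
      S.X₂.obj.map (homOfLE (inf_le_left : U x ⊓ U y ≤ U x)).op (b x) -
        S.X₂.obj.map (homOfLE (inf_le_right : U x ⊓ U y ≤ U y)).op (b y) := by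
    intro x y
    refine TopCat.Sheaf.sections_exact_of_left_exact hS.exact hS.mono_f _ ?_
    rw [map_sub, nat, nat, hb', hb', comp₃ _ _ (homOfLE le_top).op,
      comp₃ _ _ (homOfLE le_top).op, sub_self]
  choose t ht using hex
  obtain ⟨r, hr⟩ := hF U hU t fun x y z => by
    apply finj
    refine (map_add _ _ _).trans ?_
    erw [natf, natf, natf, ht, ht, ht]
    rw [map_sub, map_sub, map_sub]
    simp only [comp₂ _ _ (homOfLE (inf_le_left.trans inf_le_left : U x ⊓ U y ⊓ U z ≤ U x)).op,
      comp₂ _ _ (homOfLE (inf_le_left.trans inf_le_right : U x ⊓ U y ⊓ U z ≤ U y)).op,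
      comp₂ _ _ (homOfLE (inf_le_right : U x ⊓ U y ⊓ U z ≤ U z)).op]
    abel
  have hcov : (⊤ : Opens X) ≤ iSup U := fun x _ => Opens.mem_iSup.2 ⟨x, hU x⟩
  -- Subtracting the splitting from the local lifts makes them agree on overlaps without changing
  -- their image in the cokernel.
  obtain ⟨s, hs, -⟩ := TopCat.Sheaf.existsUnique_gluing' S.X₂ U ⊤ (fun x => homOfLE le_top) hcov
    (fun x => b x - S.f.hom.app (op (U x)) (r x)) (by
      intro x y
      have h1 := ht x y
      rw [hr x y] at h1
      have h2 := (map_sub (S.f.hom.app (op (U x ⊓ U y))).hom _ _).symm.trans h1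
      erw [natf, natf] at h2
      change S.X₂.obj.map (homOfLE inf_le_left).op _ = S.X₂.obj.map (homOfLE inf_le_right).op _
      rw [map_sub, map_sub]
      exact sub_eq_sub_iff_sub_eq_sub.1 h2.symm)
  refine ⟨s, ?_⟩
  refine TopCat.Sheaf.eq_of_locally_eq' S.X₃ U ⊤ (fun x => homOfLE le_top) hcov _ _ fun x => ?_
  have h0 : S.g.hom.app (op (U x)) (S.f.hom.app (op (U x)) (r x)) = 0 := by
    have := congrArg (fun φ => φ.hom.app (op (U x)) (r x)) S.zero
    exact this
  erw [← nat, hs x]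
  rw [map_sub, h0, sub_zero]
  exact hb' x

end SheafCohomology

namespace TrivalentGraph

variable {V E : Type} {G : TrivalentGraph V E} {e₀ : E} {q : ℂˣ}

/-! ### Cousin problems -/

/-- If every Cousin problem for `F` has a solution, then `H¹(F) = 0`. -/
theorem SectionSheaf.subsingleton_H1 {M : Type} [AddCommGroup M] [Module (RatFunc ℂ) M]
    (F : SectionSheaf G e₀ q M)
    (hF : ∀ (U : Punctured G e₀ q → Opens (Punctured G e₀ q)) (_ : ∀ x, x ∈ U x)
      (s : ∀ x, Comp (U x) → M),
      (∀ x y, restr (inf_le_left : U x ⊓ U y ≤ U x) (s x) -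
        restr (inf_le_right : U x ⊓ U y ≤ U y) (s y) ∈ F.sec (U x ⊓ U y)) →
      ∃ r : Comp (⊤ : Opens (Punctured G e₀ q)) → M,
        ∀ x, restr le_top r - s x ∈ F.sec (U x)) :
    Subsingleton F.H1 := by
  refine SheafCohomology.subsingleton_H_one F.sheaf fun U hU t ht => ?_
  let t' : ∀ x y, F.sec (U x ⊓ U y) := t
  -- A section is determined by its components at generic points. Comparing on each component with
  -- the open set chosen at its generic point exhibits the cocycle as a coboundary of unrestricted
  -- rational families.
  let s : ∀ x, Comp (U x) → M := fun x e =>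
    (t' x (genericPt G e₀ q e.1)).1 ⟨e.1, e.2, hU (genericPt G e₀ q e.1)⟩
  have hst : ∀ x y, restr (inf_le_left : U x ⊓ U y ≤ U x) (s x) -
        restr (inf_le_right : U x ⊓ U y ≤ U y) (s y) = (t' x y).1 := by
    intro x y
    funext e
    let z := genericPt G e₀ q e.1
    have h := congrArg (fun r : F.sec (U x ⊓ U y ⊓ U z) => r.1 ⟨e.1, e.2, hU z⟩) (ht x y z)
    have h' : (t' x y).1 e + (t' y z).1 ⟨e.1, e.2.2, hU z⟩ = (t' x z).1 ⟨e.1, e.2.1, hU z⟩ := h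
    exact (eq_sub_of_add_eq h').symm
  obtain ⟨r, hr⟩ := hF U hU s fun x y => by rw [hst]; exact (t' x y).2
  refine ⟨fun x => (⟨s x - restr le_top r, by
    rw [← neg_sub]; exact neg_mem (hr x)⟩ : F.sec (U x)), fun x y => Subtype.ext ?_⟩
  refine (hst x y).symm.trans ?_
  funext e
  exact (sub_sub_sub_cancel_right _ _ _).symm

theorem finite_smooth_notMem {W : Opens (Punctured G e₀ q)} {e : E}
    (h : genericPt G e₀ q e ∈ W) : {z : ℂˣ | ∀ hz : Point.smooth e z ≠ Point.smooth e₀ q,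
      (⟨Point.smooth e z, hz⟩ : Punctured G e₀ q) ∉ W}.Finite := by
  obtain ⟨W', hW', hU⟩ := isOpen_induced_iff.1 W.isOpen
  have h' : Point.generic e ∈ W' := by
    have : genericPt G e₀ q e ∈ (W : Set (Punctured G e₀ q)) := h
    rw [← hU] at this
    exact this
  -- The condition is vacuous at the puncture, so $q$ may belong to this set and is added to the
  -- finite exceptional set.
  refine ((hW'.2.2 e h').union (Set.finite_singleton q)).subset fun z hz => ?_
  by_cases hzq : Point.smooth e z = Point.smooth (G := G) e₀ q
  · right
    exact (Point.smooth.inj hzq).2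
  · left
    intro hW
    refine hz hzq ?_
    have : (⟨Point.smooth e z, hzq⟩ : Punctured G e₀ q) ∈ (W : Set (Punctured G e₀ q)) := by
      rw [← hU]; exact hW
    exact this

/-- The sheaf of functions that are regular on every component, with no condition of common
values at the nodes: the direct image of the structure sheaf of the normalization. -/
def normalizationSheaf (G : TrivalentGraph V E) (e₀ : E) (q : ℂˣ) :
    SectionSheaf G e₀ q (RatFunc ℂ) where
  sec U :=
    { carrier := {f |
        (∀ (e : Comp U) (z : ℂˣ) (hz : Point.smooth e.1 z ≠ Point.smooth e₀ q),
          (⟨Point.smooth e.1 z, hz⟩ : Punctured G e₀ q) ∈ U →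
            pointVal (OnePoint.some (z : ℂ)) (f e) ≤ 1) ∧
        (∀ (e : Comp U) (b : Bool), nodePt G e₀ q (G.endpt e.1 b) ∈ U →
          pointVal (endPoint b) (f e) ≤ 1)}
      add_mem' := fun hf hg =>
        ⟨fun e z hz h => (pointVal _).map_add_le (hf.1 e z hz h) (hg.1 e z hz h),
          fun e b h => (pointVal _).map_add_le (hf.2 e b h) (hg.2 e b h)⟩
      zero_mem' := ⟨fun e z hz h => by simp, fun e b h => by simp⟩
      smul_mem' := fun a f hf =>
        ⟨fun e z hz h => (pointVal_mul_le (a.2.1 e z hz h) (hf.1 e z hz h)).trans_eq (one_mul 1),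
          fun e b h => by
            obtain ⟨c, hc⟩ := a.2.2 _ h
            exact (pointVal_mul_le (hc e b rfl).regular (hf.2 e b h)).trans_eq (one_mul 1)⟩ }
  restr_mem h _ hs := ⟨fun e z hz hW => hs.1 ⟨e.1, h e.2⟩ z hz (h hW),
    fun e b hW => hs.2 ⟨e.1, h e.2⟩ b (h hW)⟩
  glue_mem U s hs := by
    refine ⟨fun e z hz h => ?_, fun e b h => ?_⟩
    · obtain ⟨i, hi⟩ := Opens.mem_iSup.1 h
      exact (hs i).1 ⟨e.1, generic_mem_of_smooth_mem hz hi⟩ z hz hi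
    · obtain ⟨i, hi⟩ := Opens.mem_iSup.1 h
      exact (hs i).2 ⟨e.1, generic_mem_of_node_mem hi⟩ b hi

theorem endPoint_injective : Function.Injective endPoint := by
  intro a b h
  cases a <;> cases b <;> simp_all [endPoint]

theorem endPoint_ne_some (b : Bool) (z : ℂˣ) : endPoint b ≠ OnePoint.some (z : ℂ) := by
  cases b
  · simpa [endPoint] using z.ne_zero.symm
  · simp [endPoint]

theorem exists_endPoint_or_some (p : OnePoint ℂ) :
    (∃ b, p = endPoint b) ∨ ∃ z : ℂˣ, p = OnePoint.some (z : ℂ) := by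
  rcases p with _ | z
  · exact Or.inl ⟨true, rfl⟩
  · by_cases hz : z = 0
    · exact Or.inl ⟨false, by subst hz; rfl⟩
    · exact Or.inr ⟨Units.mk0 z hz, rfl⟩

/-- Cousin problems for functions that are regular on every component have a solution. -/
theorem exists_normalization_cousin (U : Punctured G e₀ q → Opens (Punctured G e₀ q))
    (hU : ∀ x, x ∈ U x) (s : ∀ x, Comp (U x) → RatFunc ℂ)
    (hs : ∀ x y, restr (inf_le_left : U x ⊓ U y ≤ U x) (s x) -
      restr (inf_le_right : U x ⊓ U y ≤ U y) (s y) ∈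
        (normalizationSheaf G e₀ q).sec (U x ⊓ U y)) :
    ∃ r : Comp (⊤ : Opens (Punctured G e₀ q)) → RatFunc ℂ,
      ∀ x, restr le_top r - s x ∈ (normalizationSheaf G e₀ q).sec (U x) := by
  have key : ∀ e : E, ∃ r : RatFunc ℂ,
      (∀ b, pointVal (endPoint b)
        (r - s (nodePt G e₀ q (G.endpt e b)) ⟨e, generic_mem_of_node_mem (hU _)⟩) ≤ 1) ∧
      (∀ (z : ℂˣ) (hz : Point.smooth e z ≠ Point.smooth e₀ q), pointVal (OnePoint.some (z : ℂ))
        (r - s ⟨Point.smooth e z, hz⟩ ⟨e, generic_mem_of_smooth_mem hz (hU _)⟩) ≤ 1) := by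
    intro e
    let g := genericPt G e₀ q e
    -- The datum at the generic point serves as reference: differences from it are regular on a
    -- cofinite set, so only finitely many principal parts are prescribed.
    let f₀ := s g ⟨e, hU g⟩
    have hex : ∀ p : OnePoint ℂ, ∃ f : RatFunc ℂ,
        (∀ b, p = endPoint b →
          f = s (nodePt G e₀ q (G.endpt e b)) ⟨e, generic_mem_of_node_mem (hU _)⟩ - f₀) ∧
        (∀ (z : ℂˣ) (hz : Point.smooth e z ≠ Point.smooth e₀ q), p = OnePoint.some (z : ℂ) →
          f = s ⟨Point.smooth e z, hz⟩ ⟨e, generic_mem_of_smooth_mem hz (hU _)⟩ - f₀) := by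
      intro p
      rcases exists_endPoint_or_some p with ⟨b, rfl⟩ | ⟨z, rfl⟩
      · refine ⟨s (nodePt G e₀ q (G.endpt e b)) ⟨e, generic_mem_of_node_mem (hU _)⟩ - f₀,
          fun b' h => ?_, fun z _ h => absurd h (endPoint_ne_some b z)⟩
        obtain rfl := endPoint_injective h
        rfl
      · by_cases hz : Point.smooth e z = Point.smooth (G := G) e₀ q
        -- No open set contains the puncture, so any function may be prescribed there.
        · refine ⟨0, fun b h => absurd h.symm (endPoint_ne_some b z), fun w hw h => ?_⟩
          have : z = w := Units.ext (by simpa using h)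
          subst this
          exact absurd hz hw
        · refine ⟨s ⟨Point.smooth e z, hz⟩ ⟨e, generic_mem_of_smooth_mem hz (hU _)⟩ - f₀,
            fun b h => absurd h.symm (endPoint_ne_some b z), fun w hw h => ?_⟩
          have : z = w := Units.ext (by simpa using h)
          subst this
          rfl
    choose f hf hf' using hex
    obtain ⟨r, hr⟩ := exists_prescribed_principal_parts f (by
      refine (((Set.finite_range endPoint).union
        ((finite_smooth_notMem (hU g)).image fun z : ℂˣ => OnePoint.some (z : ℂ)))).subset
          fun p hp => ?_
      rcases exists_endPoint_or_some p with ⟨b, rfl⟩ | ⟨z, rfl⟩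
      · exact Or.inl ⟨b, rfl⟩
      · refine Or.inr ⟨z, fun hz hmem => hp ?_, rfl⟩
        rw [hf' _ z hz rfl]
        exact (hs ⟨Point.smooth e z, hz⟩ g).1
          ⟨e, generic_mem_of_smooth_mem hz (hU _), hU g⟩ z hz ⟨hU _, hmem⟩)
    refine ⟨r + f₀, fun b => ?_, fun z hz => ?_⟩
    · have := hr (endPoint b)
      rw [hf _ b rfl] at this
      convert this using 2
      ring
    · have := hr (OnePoint.some (z : ℂ))
      rw [hf' _ z hz rfl] at this
      convert this using 2
      ring
  choose r hr hr' using key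
  -- At a point $p$ of $U_x$ use $r-s_x=(r-s_p)+(s_p-s_x)$: the first term is regular by
  -- construction, the second by compatibility of the data.
  refine ⟨fun e => r e.1, fun x => ⟨fun e z hz h => ?_, fun e b h => ?_⟩⟩
  · have h1 := hr' e.1 z hz
    have h2 := (hs ⟨Point.smooth e.1 z, hz⟩ x).1
      ⟨e.1, generic_mem_of_smooth_mem hz (hU _), e.2⟩ z hz ⟨hU _, h⟩
    have h3 := (pointVal (OnePoint.some (z : ℂ))).map_add_le h1 h2
    convert h3 using 2
    exact (sub_add_sub_cancel _ _ _).symm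
  · have h1 := hr e.1 b
    have h2 := (hs (nodePt G e₀ q (G.endpt e.1 b)) x).2
      ⟨e.1, generic_mem_of_node_mem (hU _), e.2⟩ b ⟨hU _, h⟩
    have h3 := (pointVal (endPoint b)).map_add_le h1 h2
    convert h3 using 2
    exact (sub_add_sub_cancel _ _ _).symm

theorem subsingleton_H1_normalizationSheaf : Subsingleton (normalizationSheaf G e₀ q).H1 :=
  SectionSheaf.subsingleton_H1 _ exists_normalization_cousin

end TrivalentGraph

/-- The sheaf of complex functions on a set of points: its sections over `U` are the functions on
the preimage of `U`. -/
def pointFunctionSheaf {X : TopCat.{0}} {T : Type} (π : T → X) :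
    CategoryTheory.Sheaf (Opens.grothendieckTopology X) AddCommGrpCat.{0} where
  obj :=
    { obj := fun U => AddCommGrpCat.of ({t : T // π t ∈ U.unop} → ℂ)
      map := fun i => AddCommGrpCat.ofHom
        { toFun := fun s t => s ⟨t.1, i.unop.le t.2⟩
          map_zero' := rfl
          map_add' := fun _ _ => rfl } }
  property := by
    refine (TopCat.Presheaf.isSheaf_iff_isSheafUniqueGluing _).2 ?_
    intro ι U sf hsf
    have hcov : ∀ t : {t : T // π t ∈ iSup U}, ∃ i, π t.1 ∈ U i := fun t => Opens.mem_iSup.1 t.2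
    choose k hk using hcov
    let sf' : ∀ i, {t : T // π t ∈ U i} → ℂ := sf
    have key : ∀ (i : ι) (t : {t : T // π t ∈ U i}) (h : π t.1 ∈ iSup U),
        sf' (k ⟨t.1, h⟩) ⟨t.1, hk ⟨t.1, h⟩⟩ = sf' i t := by
      intro i t h
      exact congrArg (fun s : {x : T // π x ∈ U (k ⟨t.1, h⟩) ⊓ U i} → ℂ =>
        s ⟨t.1, hk ⟨t.1, h⟩, t.2⟩) (hsf (k ⟨t.1, h⟩) i)
    refine ⟨(fun t => sf' (k t) ⟨t.1, hk t⟩ : {t : T // π t ∈ iSup U} → ℂ), fun i => ?_,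
      fun s hs => ?_⟩
    · exact funext fun t => key i t (le_iSup U i t.2)
    · refine funext fun t => ?_
      exact congrArg (fun s : {x : T // π x ∈ U (k t)} → ℂ => s ⟨t.1, hk t⟩) (hs (k t))

namespace TrivalentGraph

variable {V E : Type} {G : TrivalentGraph V E} {e₀ : E} {q : ℂˣ}

/-! ### The normalization sequence -/

theorem exists_half_edge (G : TrivalentGraph V E) (v : V) :
    ∃ h : E × Bool, G.endpt h.1 h.2 = v := by
  by_contra! hne
  have : IsEmpty {h : E × Bool // G.endpt h.1 h.2 = v} := ⟨fun h => hne h.1 h.2⟩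
  have h3 := G.trivalent v
  simp at h3

/-- A chosen half-edge at a vertex. -/
def baseHalf (G : TrivalentGraph V E) (v : V) : E × Bool := (exists_half_edge G v).choose

theorem endpt_baseHalf (G : TrivalentGraph V E) (v : V) :
    G.endpt (G.baseHalf v).1 (G.baseHalf v).2 = v := (exists_half_edge G v).choose_spec

/-- The half-edges other than the chosen ones. -/
abbrev FreeHalf (G : TrivalentGraph V E) : Type :=
  {h : E × Bool // h ≠ G.baseHalf (G.endpt h.1 h.2)}

/-- The node to which a half-edge is attached. -/
def freeHalfNode (G : TrivalentGraph V E) (e₀ : E) (q : ℂˣ) (h : FreeHalf G) :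
    Punctured G e₀ q := nodePt G e₀ q (G.endpt h.1.1 h.1.2)

/-- The quotient of the normalization sheaf by the structure sheaf. -/
def gluingSheaf (G : TrivalentGraph V E) (e₀ : E) (q : ℂˣ) :
    CategoryTheory.Sheaf (Opens.grothendieckTopology (Punctured G e₀ q)) AddCommGrpCat.{0} :=
  pointFunctionSheaf (freeHalfNode G e₀ q)

theorem valueAt_add {p : OnePoint ℂ} {f g : RatFunc ℂ} (hf : pointVal p f ≤ 1)
    (hg : pointVal p g ≤ 1) : valueAt p (f + g) = valueAt p f + valueAt p g :=
  ((hasValueAt_valueAt hf).add (hasValueAt_valueAt hg)).valueAt_eq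

theorem base_mem {U : Opens (Punctured G e₀ q)} {v : V} (h : nodePt G e₀ q v ∈ U) :
    genericPt G e₀ q (G.baseHalf v).1 ∈ U :=
  generic_mem_of_node_mem (b := (G.baseHalf v).2) (by rwa [endpt_baseHalf])

/-- The failure of a family of functions to have common values at the nodes. -/
def gluingDefect {U : Opens (Punctured G e₀ q)} (f : Comp U → RatFunc ℂ)
    (h : {h : FreeHalf G // freeHalfNode G e₀ q h ∈ U}) : ℂ :=
  valueAt (endPoint h.1.1.2) (f ⟨h.1.1.1, generic_mem_of_node_mem h.2⟩) -
    valueAt (endPoint (G.baseHalf (G.endpt h.1.1.1 h.1.1.2)).2)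
      (f ⟨(G.baseHalf (G.endpt h.1.1.1 h.1.1.2)).1, base_mem h.2⟩)

theorem regular_half {U : Opens (Punctured G e₀ q)} {f : Comp U → RatFunc ℂ}
    (hf : f ∈ (normalizationSheaf G e₀ q).sec U) (h : {h : FreeHalf G // freeHalfNode G e₀ q h ∈ U}) :
    pointVal (endPoint h.1.1.2) (f ⟨h.1.1.1, generic_mem_of_node_mem h.2⟩) ≤ 1 :=
  hf.2 ⟨h.1.1.1, generic_mem_of_node_mem h.2⟩ _ h.2

theorem regular_base {U : Opens (Punctured G e₀ q)} {f : Comp U → RatFunc ℂ}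
    (hf : f ∈ (normalizationSheaf G e₀ q).sec U) {v : V} (h : nodePt G e₀ q v ∈ U) :
    pointVal (endPoint (G.baseHalf v).2) (f ⟨(G.baseHalf v).1, base_mem h⟩) ≤ 1 :=
  hf.2 ⟨(G.baseHalf v).1, base_mem h⟩ _ (by rwa [endpt_baseHalf])

theorem gluingDefect_add {U : Opens (Punctured G e₀ q)} {f g : Comp U → RatFunc ℂ}
    (hf : f ∈ (normalizationSheaf G e₀ q).sec U) (hg : g ∈ (normalizationSheaf G e₀ q).sec U) :
    gluingDefect (f + g) = gluingDefect f + gluingDefect g := by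
  funext h
  simp only [gluingDefect, Pi.add_apply]
  rw [valueAt_add (regular_half hf h) (regular_half hg h),
    valueAt_add (regular_base hf h.2) (regular_base hg h.2)]
  ring

/-- Comparing every half-edge at a node with one chosen half-edge is enough; the common value is the
value on the chosen one. -/
theorem mem_regularFunctions_iff {U : Opens (Punctured G e₀ q)} {f : Comp U → RatFunc ℂ} :
    f ∈ regularFunctions U ↔
      f ∈ (normalizationSheaf G e₀ q).sec U ∧ gluingDefect f = 0 := by
  constructor
  · intro hf
    refine ⟨⟨hf.1, fun e b h => ?_⟩, funext fun h => ?_⟩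
    · obtain ⟨c, hc⟩ := hf.2 _ h
      exact (hc e b rfl).regular
    · obtain ⟨c, hc⟩ := hf.2 _ h.2
      rw [gluingDefect, (hc ⟨_, generic_mem_of_node_mem h.2⟩ _ rfl).valueAt_eq,
        (hc ⟨_, base_mem h.2⟩ _ (endpt_baseHalf G _)).valueAt_eq, sub_self]
      rfl
  · rintro ⟨hf, h0⟩
    refine ⟨hf.1, fun v hv =>
      ⟨valueAt (endPoint (G.baseHalf v).2) (f ⟨(G.baseHalf v).1, base_mem hv⟩), ?_⟩⟩
    rintro e b rfl
    by_cases heb : (e.1, b) = G.baseHalf (G.endpt e.1 b)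
    · have h := hasValueAt_valueAt (regular_base hf hv)
      -- The component index depends on the half-edge, so the equality is eliminated with the
      -- half-edge generalized.
      have key : ∀ (h : E × Bool) (hh : genericPt G e₀ q h.1 ∈ U), (e.1, b) = h →
          HasValueAt (endPoint h.2) (f ⟨h.1, hh⟩) (valueAt (endPoint h.2) (f ⟨h.1, hh⟩)) →
          HasValueAt (endPoint b) (f e) (valueAt (endPoint h.2) (f ⟨h.1, hh⟩)) := by
        rintro h hh rfl h1
        exact h1
      exact key _ _ heb h
    · have h1 := congrFun h0 ⟨⟨(e.1, b), heb⟩, hv⟩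
      rw [gluingDefect, Pi.zero_apply, sub_eq_zero] at h1
      have h2 := hasValueAt_valueAt (hf.2 e b hv)
      exact h1 ▸ h2

/-- The inclusion of the structure sheaf in the normalization sheaf. -/
def normalizationInclusion (G : TrivalentGraph V E) (e₀ : E) (q : ℂˣ) :
    (structureSheaf G e₀ q).sheaf ⟶ (normalizationSheaf G e₀ q).sheaf :=
  ⟨{ app := fun U => AddCommGrpCat.ofHom
        { toFun := fun f : (structureSheaf G e₀ q).sec U.unop =>
            (⟨f.1, (mem_regularFunctions_iff.1 f.2).1⟩ : (normalizationSheaf G e₀ q).sec U.unop)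
          map_zero' := rfl
          map_add' := fun _ _ => rfl }
     naturality := fun _ _ _ => rfl }⟩

/-- The map from the normalization sheaf to the gluing sheaf. -/
def gluingMap (G : TrivalentGraph V E) (e₀ : E) (q : ℂˣ) :
    (normalizationSheaf G e₀ q).sheaf ⟶ gluingSheaf G e₀ q :=
  ⟨{ app := fun U => AddCommGrpCat.ofHom (AddMonoidHom.mk'
        (fun f : (normalizationSheaf G e₀ q).sec U.unop => gluingDefect f.1)
        (fun f g => gluingDefect_add f.2 g.2))
     naturality := fun _ _ _ => rfl }⟩

theorem normalizationInclusion_gluingMap :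
    normalizationInclusion G e₀ q ≫ gluingMap G e₀ q = 0 := by
  apply CategoryTheory.Sheaf.hom_ext
  ext U f
  exact (mem_regularFunctions_iff.1 f.2).2

/-- The normalization sequence. -/
def normalizationSequence (G : TrivalentGraph V E) (e₀ : E) (q : ℂˣ) : ShortComplex
    (CategoryTheory.Sheaf (Opens.grothendieckTopology (Punctured G e₀ q)) AddCommGrpCat.{0}) :=
  ShortComplex.mk (normalizationInclusion G e₀ q) (gluingMap G e₀ q)
    normalizationInclusion_gluingMap

/-- The structure sheaf is the kernel of the gluing map. -/
def normalizationKernel (G : TrivalentGraph V E) (e₀ : E) (q : ℂˣ) :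
    Limits.IsLimit (Limits.KernelFork.ofι (normalizationInclusion G e₀ q)
      (normalizationInclusion_gluingMap (G := G) (e₀ := e₀) (q := q))) :=
  Limits.KernelFork.IsLimit.ofι _ _
    (fun {W} k hk => ⟨{
      app := fun U => AddCommGrpCat.ofHom
        { toFun := fun s => (⟨((k.hom.app U).hom s : (normalizationSheaf G e₀ q).sec U.unop).1,
            mem_regularFunctions_iff.2 ⟨((k.hom.app U).hom s :
              (normalizationSheaf G e₀ q).sec U.unop).2,
              congrArg (fun φ => (φ.hom.app U).hom s) hk⟩⟩ : (structureSheaf G e₀ q).sec U.unop)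
          map_zero' := Subtype.ext (congrArg
            (Subtype.val : (normalizationSheaf G e₀ q).sec U.unop → _)
            (map_zero (k.hom.app U).hom))
          map_add' := fun s t => Subtype.ext (congrArg
            (Subtype.val : (normalizationSheaf G e₀ q).sec U.unop → _)
            (map_add (k.hom.app U).hom s t)) }
      naturality := fun U U' i => by
        ext s
        exact Subtype.ext (congrArg
          (Subtype.val : (normalizationSheaf G e₀ q).sec U'.unop → _) (NatTrans.naturality_apply k.hom i s)) }⟩)
    (fun k hk => by
      apply CategoryTheory.Sheaf.hom_ext
      ext U s
      rfl)
    (fun k hk m hm => by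
      apply CategoryTheory.Sheaf.hom_ext
      ext U s
      refine Subtype.ext ?_
      exact congrArg (fun φ => ((φ.hom.app U).hom s : (normalizationSheaf G e₀ q).sec U.unop).1) hm)

theorem isOpen_avoid (G : TrivalentGraph V E) (q : ℂˣ) :
    IsOpen {p : Point G | ∀ e, p ≠ Point.smooth e q} := by
  refine ⟨fun e b _ => by simp, fun e z _ => by simp, fun e _ => ?_⟩
  refine (Set.finite_singleton q).subset fun z hz => ?_
  simpa using hz

theorem isOpen_not_node (G : TrivalentGraph V E) : IsOpen {p : Point G | ∀ v, p ≠ Point.node v} := by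
  refine ⟨fun e b _ => by simp, fun e z _ => by simp, fun e _ => ?_⟩
  simp

/-- Near a point whose coordinate is not $q$, delete the points with coordinate $q$ from all
components; polynomials of degree at most one in $t$ then interpolate any end values. Near the
remaining points delete the nodes, where the target lives. -/
theorem epi_gluingMap : Epi (gluingMap G e₀ q) := by
  refine (TopCat.Sheaf.isLocallySurjective_iff_epi (gluingMap G e₀ q)).1
    ((TopCat.Presheaf.isLocallySurjective_iff _).2 fun U y x hx => ?_)
  by_cases hxq : ∃ e, x.1 = Point.smooth e q
  · let N : Opens (Punctured G e₀ q) := ⟨_, (isOpen_not_node G).preimage continuous_subtype_val⟩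
    refine ⟨U ⊓ N, inf_le_left, ⟨(0 : (normalizationSheaf G e₀ q).sec (U ⊓ N)), ?_⟩, hx, ?_⟩
    · have : IsEmpty {h : FreeHalf G // freeHalfNode G e₀ q h ∈ U ⊓ N} :=
        ⟨fun h => h.2.2 _ rfl⟩
      exact Subsingleton.elim (α := {h : FreeHalf G // freeHalfNode G e₀ q h ∈ U ⊓ N} → ℂ) _ _
    · obtain ⟨e, he⟩ := hxq
      intro v hv
      rw [he] at hv
      cases hv
  · let N : Opens (Punctured G e₀ q) := ⟨_, (isOpen_avoid G q).preimage continuous_subtype_val⟩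
    let y' : {h : FreeHalf G // freeHalfNode G e₀ q h ∈ U} → ℂ := y
    classical
    let w : E × Bool → ℂ := fun h =>
      if hh : ∃ hb : h ≠ G.baseHalf (G.endpt h.1 h.2), freeHalfNode G e₀ q ⟨h, hb⟩ ∈ U then
        y' ⟨⟨h, hh.1⟩, hh.2⟩ else 0
    let P : E → Polynomial ℂ := fun e => Polynomial.C (w (e, false)) +
      Polynomial.C (w (e, true) - w (e, false)) * Polynomial.X
    let f : Comp (U ⊓ N) → RatFunc ℂ := fun e => Polynomial.aeval (affineCoord q) (P e.1)
    have hval : ∀ (e : Comp (U ⊓ N)) b, HasValueAt (endPoint b) (f e) (w (e.1, b)) := by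
      intro e b
      cases b
      · have := hasValueAt_aeval_zero q (P e.1)
        simpa [P, f, endPoint] using this
      · have := hasValueAt_aeval_infty q (P e.1)
        simpa [P, f, endPoint] using this
    have hf : f ∈ (normalizationSheaf G e₀ q).sec (U ⊓ N) := by
      refine ⟨fun e z hz h => pointVal_aeval_le ?_ _, fun e b _ => (hval e b).regular⟩
      intro hzq
      have : z = q := Units.ext (by simpa using hzq)
      subst this
      exact h.2 e.1 rfl
    refine ⟨U ⊓ N, inf_le_left, ⟨(⟨f, hf⟩ : (normalizationSheaf G e₀ q).sec (U ⊓ N)), ?_⟩, hx, ?_⟩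
    · refine funext fun h => ?_
      change gluingDefect f h = y' ⟨h.1, h.2.1⟩
      rw [gluingDefect, (hval _ _).valueAt_eq, (hval _ _).valueAt_eq]
      have h1 : w (h.1.1.1, h.1.1.2) = y' ⟨h.1, h.2.1⟩ := dif_pos ⟨h.1.2, h.2.1⟩
      -- The interpolated values are zero on the chosen half-edges, so the defect is the prescribed
      -- value itself.
      have h2 : w (G.baseHalf (G.endpt h.1.1.1 h.1.1.2)) = 0 := by
        refine dif_neg ?_
        rintro ⟨hb, -⟩
        rw [endpt_baseHalf] at hb
        exact hb rfl
      exact (congrArg₂ (· - ·) h1 h2).trans (sub_zero _)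
    · exact fun e he => hxq ⟨e, he⟩

theorem normalizationSequence_shortExact : (normalizationSequence G e₀ q).ShortExact where
  exact := ShortComplex.exact_of_f_is_kernel _ (normalizationKernel G e₀ q)
  mono_f := Limits.mono_of_isLimit_fork (normalizationKernel G e₀ q)
  epi_g := epi_gluingMap

/-- The map from functions on half-edges to `H¹(𝒪)`. -/
def edgeClass (G : TrivalentGraph V E) (e₀ : E) (q : ℂˣ) :
    ({h : FreeHalf G // freeHalfNode G e₀ q h ∈ (⊤ : Opens (Punctured G e₀ q))} → ℂ) →+
      (structureSheaf G e₀ q).H1 :=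
  SheafCohomology.connecting (normalizationSequence_shortExact (G := G) (e₀ := e₀) (q := q))

theorem edgeClass_surjective : Function.Surjective (edgeClass G e₀ q) := by
  have : Subsingleton (CategoryTheory.Sheaf.H.{0} (normalizationSequence G e₀ q).X₂ 1) :=
    subsingleton_H1_normalizationSheaf (G := G) (e₀ := e₀) (q := q)
  exact SheafCohomology.connecting_surjective _

theorem edgeClass_eq_zero_iff
    (y : {h : FreeHalf G // freeHalfNode G e₀ q h ∈ (⊤ : Opens (Punctured G e₀ q))} → ℂ) :
    edgeClass G e₀ q y = 0 ↔ ∃ f ∈ (normalizationSheaf G e₀ q).sec ⊤, gluingDefect f = y := by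
  refine (SheafCohomology.connecting_eq_zero_iff normalizationSequence_shortExact y).trans ?_
  constructor
  · rintro ⟨b, hb⟩
    exact ⟨(b : (normalizationSheaf G e₀ q).sec ⊤).1,
      (b : (normalizationSheaf G e₀ q).sec ⊤).2, hb⟩
  · rintro ⟨f, hf, h⟩
    exact ⟨(⟨f, hf⟩ : (normalizationSheaf G e₀ q).sec ⊤), h⟩

/-- Scalar multiplication on the gluing sheaf. -/
def gluingScale (G : TrivalentGraph V E) (e₀ : E) (q : ℂˣ) (c : ℂ) :
    gluingSheaf G e₀ q ⟶ gluingSheaf G e₀ q :=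
  ⟨{ app := fun U => AddCommGrpCat.ofHom (DistribSMul.toAddMonoidHom
        ({h : FreeHalf G // freeHalfNode G e₀ q h ∈ U.unop} → ℂ) c)
     naturality := fun _ _ _ => rfl }⟩

/-- If all node values of a function equal $c$, it multiplies differences of values at the nodes by
$c$, and the connecting map is natural. -/
theorem smul_edgeClass (a : GlobalFunctions G e₀ q) (c : ℂ)
    (hc : ∀ (e : Comp (⊤ : Opens (Punctured G e₀ q))) b, HasValueAt (endPoint b) (a.1 e) c)
    (y : {h : FreeHalf G // freeHalfNode G e₀ q h ∈ (⊤ : Opens (Punctured G e₀ q))} → ℂ) :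
    a • edgeClass G e₀ q y = edgeClass G e₀ q (c • y) := by
  let φ : normalizationSequence G e₀ q ⟶ normalizationSequence G e₀ q :=
    { τ₁ := (structureSheaf G e₀ q).mulEnd a
      τ₂ := (normalizationSheaf G e₀ q).mulEnd a
      τ₃ := gluingScale G e₀ q c
      comm₁₂ := rfl
      comm₂₃ := by
        apply CategoryTheory.Sheaf.hom_ext
        ext U f
        let f' : (normalizationSheaf G e₀ q).sec U.unop := f
        refine funext fun h => ?_
        have e1 : valueAt (endPoint h.1.1.2) (a.1 ⟨h.1.1.1, trivial⟩ *
            f'.1 ⟨h.1.1.1, generic_mem_of_node_mem h.2⟩) = c * valueAt (endPoint h.1.1.2)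
              (f'.1 ⟨h.1.1.1, generic_mem_of_node_mem h.2⟩) :=
          ((hc ⟨h.1.1.1, trivial⟩ _).mul (hasValueAt_valueAt (regular_half f'.2 h))).valueAt_eq
        have e2 := ((hc ⟨(G.baseHalf (G.endpt h.1.1.1 h.1.1.2)).1, trivial⟩ _).mul
          (hasValueAt_valueAt (regular_base f'.2 h.2))).valueAt_eq
        exact (congrArg₂ (· - ·) e1 e2).trans (mul_sub _ _ _).symm }
  exact SheafCohomology.map_connecting normalizationSequence_shortExact φ y

end TrivalentGraph

namespace TrivalentGraph

variable {V E : Type} {G : TrivalentGraph V E} {e₀ : E}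

/-! ### Chains and cochains of a graph with an edge removed -/

/-- The coboundary of the graph with the edge `e₀` removed. -/
def coboundary (G : TrivalentGraph V E) (e₀ : E) : (V → ℂ) →ₗ[ℂ] ({e : E // e ≠ e₀} → ℂ) where
  toFun l e := l (G.endpt e.1 true) - l (G.endpt e.1 false)
  map_add' l m := by funext e; simp; ring
  map_smul' c l := by funext e; simp; ring

theorem IsNonseparating.eq_of_coboundary_eq_zero (h : G.IsNonseparating e₀) {l : V → ℂ}
    (hl : coboundary G e₀ l = 0) (v w : V) : l v = l w := by
  induction h v w with
  | rel a b hab =>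
    obtain ⟨e, he, rfl, rfl⟩ := hab
    exact (sub_eq_zero.1 (congrFun hl ⟨e, he⟩)).symm
  | refl a => rfl
  | symm a b _ ih => exact ih.symm
  | trans a b c _ _ ih₁ ih₂ => exact ih₁.trans ih₂

/-- Half-edges are counted once by edges and once by vertices. -/
theorem two_mul_card_edges [Fintype V] [DecidableEq V] [Fintype E] (G : TrivalentGraph V E) :
    2 * Fintype.card E = 3 * Fintype.card V := by
  have h1 := Fintype.card_congr (Equiv.sigmaFiberEquiv fun h : E × Bool => G.endpt h.1 h.2)
  rw [Fintype.card_sigma, Fintype.card_prod, Fintype.card_bool] at h1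
  have h2 : ∀ v, Fintype.card {h : E × Bool // G.endpt h.1 h.2 = v} = 3 := fun v => by
    rw [← Nat.card_eq_fintype_card]; exact G.trivalent v
  simp only [h2, Finset.sum_const, Finset.card_univ, smul_eq_mul] at h1
  omega

theorem finrank_ker_coboundary [Nonempty V] (h : G.IsNonseparating e₀) :
    Module.finrank ℂ (LinearMap.ker (coboundary G e₀)) = 1 := by
  let one : LinearMap.ker (coboundary G e₀) :=
    ⟨fun _ => 1, by rw [LinearMap.mem_ker]; funext e; simp [coboundary]⟩
  obtain ⟨v₀⟩ := ‹Nonempty V›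
  refine finrank_eq_one one ?_ fun l => ⟨l.1 v₀, Subtype.ext (funext fun v => ?_)⟩
  · intro h0
    have := congrFun (congrArg Subtype.val h0) v₀
    simp [one] at this
  · simpa [one] using h.eq_of_coboundary_eq_zero l.2 v₀ v

section Finite

variable [Fintype V] [DecidableEq V] [Fintype E] [DecidableEq E]

/-- The net outflow of an edge function at the vertices. -/
def divergence (G : TrivalentGraph V E) (e₀ : E) : ({e : E // e ≠ e₀} → ℂ) →ₗ[ℂ] (V → ℂ) where
  toFun ρ v := ∑ e : {e : E // e ≠ e₀}, ((if G.endpt e.1 false = v then ρ e else 0) -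
    (if G.endpt e.1 true = v then ρ e else 0))
  map_add' ρ σ := by
    funext v
    simp only [Pi.add_apply, ← Finset.sum_add_distrib]
    refine Finset.sum_congr rfl fun e _ => ?_
    split_ifs <;> ring
  map_smul' c ρ := by
    funext v
    simp only [Pi.smul_apply, smul_eq_mul, RingHom.id_apply, Finset.mul_sum]
    refine Finset.sum_congr rfl fun e _ => ?_
    split_ifs <;> ring

theorem sum_mul_divergence (l : V → ℂ) (ρ : {e : E // e ≠ e₀} → ℂ) :
    ∑ v, l v * divergence G e₀ ρ v = -∑ e, coboundary G e₀ l e * ρ e := by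
  simp only [divergence, coboundary, LinearMap.coe_mk, AddHom.coe_mk, Finset.mul_sum]
  rw [Finset.sum_comm, ← Finset.sum_neg_distrib]
  refine Finset.sum_congr rfl fun e _ => ?_
  simp only [mul_sub, Finset.sum_sub_distrib, mul_ite, mul_zero, Finset.sum_ite_eq,
    Finset.mem_univ, if_true]
  ring

/-- Divergence is minus the transpose of the coboundary. A functional vanishing on its range is thus
a vertex function with zero coboundary, which is constant by connectedness, so the total is the only
obstruction. -/
theorem IsNonseparating.mem_range_divergence (h : G.IsNonseparating e₀) (μ : V → ℂ) :
    μ ∈ LinearMap.range (divergence G e₀) ↔ ∑ v, μ v = 0 := by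
  constructor
  · rintro ⟨ρ, rfl⟩
    have := sum_mul_divergence (G := G) (e₀ := e₀) (fun _ => 1) ρ
    simpa [coboundary] using this
  · intro hμ
    by_contra hmem
    obtain ⟨f, hf, hf'⟩ := Submodule.exists_le_ker_of_notMem hmem
    let l : V → ℂ := fun v => f (Pi.single v 1)
    have hfl : ∀ m : V → ℂ, f m = ∑ v, l v * m v := by
      intro m
      conv_lhs => rw [pi_eq_sum_univ' m]
      rw [map_sum]
      refine Finset.sum_congr rfl fun v _ => ?_
      rw [map_smul, smul_eq_mul, mul_comm]
    have hl : coboundary G e₀ l = 0 := by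
      funext e
      have h1 : f (divergence G e₀ (Pi.single e 1)) = 0 := hf' ⟨_, rfl⟩
      rw [hfl, sum_mul_divergence] at h1
      simpa [Pi.single_apply] using h1
    have hc := h.eq_of_coboundary_eq_zero hl
    apply hf
    rw [hfl]
    rcases isEmpty_or_nonempty V with hV | ⟨⟨v₀⟩⟩
    · simp
    · simp_rw [fun v => hc v v₀]
      rw [← Finset.mul_sum, hμ, mul_zero]

theorem finrank_ker_divergence [Nonempty V] (h : G.IsNonseparating e₀) :
    Module.finrank ℂ (LinearMap.ker (divergence G e₀)) + Fintype.card V = Fintype.card E := by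
  have h1 := LinearMap.finrank_range_add_finrank_ker (divergence G e₀)
  let s : (V → ℂ) →ₗ[ℂ] ℂ := ∑ v, LinearMap.proj v
  have hs : ∀ m, s m = ∑ v, m v := fun m => by simp [s]
  have h2 : LinearMap.range (divergence G e₀) = LinearMap.ker s := by
    ext m
    rw [h.mem_range_divergence, LinearMap.mem_ker, hs]
  have h3 := LinearMap.finrank_range_add_finrank_ker s
  have h4 : LinearMap.range s = ⊤ := LinearMap.range_eq_top.2 fun c => by
    obtain ⟨v₀⟩ := ‹Nonempty V›
    exact ⟨Pi.single v₀ c, by rw [hs]; simp⟩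
  rw [h4, finrank_top, Module.finrank_self, Module.finrank_pi] at h3
  rw [h2, Module.finrank_pi, Fintype.card_subtype_compl, Fintype.card_subtype_eq] at h1
  have : 0 < Fintype.card E := Fintype.card_pos_iff.2 ⟨e₀⟩
  omega

end Finite

theorem finrank_quotient_range_coboundary [Fintype V] [Fintype E] [DecidableEq E]
    [Nonempty V] (h : G.IsNonseparating e₀) :
    Module.finrank ℂ (({e : E // e ≠ e₀} → ℂ) ⧸ LinearMap.range (coboundary G e₀)) +
      Fintype.card V = Fintype.card E := by
  have h1 := LinearMap.finrank_range_add_finrank_ker (coboundary G e₀)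
  have h2 := Submodule.finrank_quotient_add_finrank (LinearMap.range (coboundary G e₀))
  rw [finrank_ker_coboundary h, Module.finrank_pi] at h1
  rw [Module.finrank_pi, Fintype.card_subtype_compl, Fintype.card_subtype_eq] at h2
  have : 0 < Fintype.card E := Fintype.card_pos_iff.2 ⟨e₀⟩
  omega

/-! ### The first cohomology of the structure sheaf -/

variable {q : ℂˣ}

/-- The differences of a function on half-edges with its values at the chosen half-edges. -/
def halfDefect (G : TrivalentGraph V E) (e₀ : E) (q : ℂˣ) (u : E × Bool → ℂ)
    (h : {h : FreeHalf G // freeHalfNode G e₀ q h ∈ (⊤ : Opens (Punctured G e₀ q))}) : ℂ :=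
  u h.1.1 - u (G.baseHalf (G.endpt h.1.1.1 h.1.1.2))

theorem gluingDefect_eq_halfDefect {f : Comp (⊤ : Opens (Punctured G e₀ q)) → RatFunc ℂ}
    {u : E × Bool → ℂ} (h : ∀ e b, HasValueAt (endPoint b) (f ⟨e, trivial⟩) (u (e, b))) :
    gluingDefect f = halfDefect G e₀ q u := by
  funext k
  rw [gluingDefect, (h _ _).valueAt_eq, (h _ _).valueAt_eq]
  rfl

theorem halfDefect_endpt (l : V → ℂ) :
    halfDefect G e₀ q (fun h => l (G.endpt h.1 h.2)) = 0 := by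
  funext k
  simp [halfDefect, endpt_baseHalf]

/-- Interpolation linear in $t$ works on all edges at once: off $e_0$ the slope vanishes, so no pole
appears at the point with coordinate $q$. -/
theorem exists_normalization_section {u : E × Bool → ℂ}
    (hu : ∀ e, e ≠ e₀ → u (e, true) = u (e, false)) :
    ∃ f ∈ (normalizationSheaf G e₀ q).sec ⊤,
      ∀ e b, HasValueAt (endPoint b) (f ⟨e, trivial⟩) (u (e, b)) := by
  let f : Comp (⊤ : Opens (Punctured G e₀ q)) → RatFunc ℂ := fun e =>
    Polynomial.aeval (affineCoord q) (Polynomial.C (u (e.1, false)) +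
      Polynomial.C (u (e.1, true) - u (e.1, false)) * Polynomial.X)
  have hval : ∀ e b, HasValueAt (endPoint b) (f ⟨e, trivial⟩) (u (e, b)) := by
    intro e b
    cases b
    · have := hasValueAt_aeval_zero q (Polynomial.C (u (e, false)) +
        Polynomial.C (u (e, true) - u (e, false)) * Polynomial.X)
      simpa [f, endPoint] using this
    · have := hasValueAt_aeval_infty q (Polynomial.C (u (e, false)) +
        Polynomial.C (u (e, true) - u (e, false)) * Polynomial.X)
      simpa [f, endPoint] using this
  refine ⟨f, ⟨fun e z hz _ => ?_, fun e b _ => (hval e.1 b).regular⟩, hval⟩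
  by_cases he : e.1 = e₀
  · refine pointVal_aeval_le ?_ _
    intro hzq
    have : z = q := Units.ext (by simpa using hzq)
    exact hz (by rw [he, this])
  · have : f e = RatFunc.C (u (e.1, false)) := by simp [f, hu e.1 he]
    rw [this]
    exact pointVal_C_le _ _

theorem section_regular {f : Comp (⊤ : Opens (Punctured G e₀ q)) → RatFunc ℂ}
    (hf : f ∈ (normalizationSheaf G e₀ q).sec ⊤) (e : Comp (⊤ : Opens (Punctured G e₀ q)))
    (p : OnePoint ℂ) (hp : e.1 = e₀ → p ≠ OnePoint.some (q : ℂ)) : pointVal p (f e) ≤ 1 := by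
  rcases exists_endPoint_or_some p with ⟨b, rfl⟩ | ⟨z, rfl⟩
  · exact hf.2 e b trivial
  · refine hf.1 e z (fun h => ?_) trivial
    obtain ⟨h1, h2⟩ := Point.smooth.inj h
    exact hp h1 (by rw [h2])

theorem section_eq_C {f : Comp (⊤ : Opens (Punctured G e₀ q)) → RatFunc ℂ}
    (hf : f ∈ (normalizationSheaf G e₀ q).sec ⊤) {e : E} (he : e ≠ e₀) :
    ∃ c, f ⟨e, trivial⟩ = RatFunc.C c :=
  exists_eq_C fun p => section_regular hf ⟨e, trivial⟩ p fun h => absurd h he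

theorem section_eq_aeval {f : Comp (⊤ : Opens (Punctured G e₀ q)) → RatFunc ℂ}
    (hf : f ∈ (normalizationSheaf G e₀ q).sec ⊤) :
    ∃ P : Polynomial ℂ, Polynomial.aeval (affineCoord q) P = f ⟨e₀, trivial⟩ :=
  exists_aeval_eq fun p hp => section_regular hf ⟨e₀, trivial⟩ p fun _ => hp

/-- Extension of an edge function to half-edges, supported on the ends `∞`. -/
def extendHalf [DecidableEq E] (e₀ : E) : ({e : E // e ≠ e₀} → ℂ) →ₗ[ℂ] (E × Bool → ℂ) where
  toFun w h := if hh : h.1 ≠ e₀ then (if h.2 then w ⟨h.1, hh⟩ else 0) else 0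
  map_add' w w' := by funext h; by_cases h1 : h.1 = e₀ <;> cases h2 : h.2 <;> simp [h1, h2]
  map_smul' c w := by funext h; by_cases h1 : h.1 = e₀ <;> cases h2 : h.2 <;> simp [h1, h2]

theorem extendHalf_true [DecidableEq E] (w : {e : E // e ≠ e₀} → ℂ) {e : E} (he : e ≠ e₀) :
    extendHalf e₀ w (e, true) = w ⟨e, he⟩ := by simp [extendHalf, he]

theorem extendHalf_false [DecidableEq E] (w : {e : E // e ≠ e₀} → ℂ) (e : E) :
    extendHalf e₀ w (e, false) = 0 := by simp [extendHalf]

/-- The values of a global function at the nodes. -/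
def HasNodeValue (a : GlobalFunctions G e₀ q) (c : ℂ) : Prop :=
  ∀ (e : Comp (⊤ : Opens (Punctured G e₀ q))) b, HasValueAt (endPoint b) (a.1 e) c

theorem hasNodeValue_algebraMap (c : ℂ) :
    HasNodeValue (algebraMap ℂ (GlobalFunctions G e₀ q) c) c :=
  fun _ _ => hasValueAt_C _ c

/-- The class in `H¹(𝒪)` of a cochain of the graph without the edge `e₀`. -/
def cochainClass [DecidableEq E] (G : TrivalentGraph V E) (e₀ : E) (q : ℂˣ) :
    ({e : E // e ≠ e₀} → ℂ) →ₗ[ℂ] (structureSheaf G e₀ q).H1 where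
  toFun w := edgeClass G e₀ q (halfDefect G e₀ q (extendHalf e₀ w))
  map_add' w w' := by
    rw [← map_add, map_add (extendHalf e₀)]
    congr 1
    funext h
    simp only [halfDefect, Pi.add_apply]
    ring
  map_smul' c w := by
    rw [map_smul]
    refine Eq.trans ?_ (smul_edgeClass (algebraMap ℂ (GlobalFunctions G e₀ q) c) c
      (hasNodeValue_algebraMap c) _).symm
    congr 1
    funext h
    simp only [halfDefect, Pi.smul_apply, smul_eq_mul]
    ring

theorem smul_cochainClass [DecidableEq E] {a : GlobalFunctions G e₀ q} {c : ℂ}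
    (hc : HasNodeValue a c) (w : {e : E // e ≠ e₀} → ℂ) :
    a • cochainClass G e₀ q w = c • cochainClass G e₀ q w :=
  (smul_edgeClass a c hc _).trans (smul_edgeClass (algebraMap ℂ (GlobalFunctions G e₀ q) c) c
      (hasNodeValue_algebraMap c) _).symm

theorem cochainClass_surjective [DecidableEq E] :
    Function.Surjective (cochainClass G e₀ q) := by
  intro x
  obtain ⟨y, rfl⟩ := edgeClass_surjective x
  classical
  let u : E × Bool → ℂ := fun h =>
    if hb : h ≠ G.baseHalf (G.endpt h.1 h.2) then y ⟨⟨h, hb⟩, trivial⟩ else 0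
  have hy : y = halfDefect G e₀ q u := by
    funext h
    have h2 : u (G.baseHalf (G.endpt h.1.1.1 h.1.1.2)) = 0 :=
      dif_neg (by rw [endpt_baseHalf]; simp)
    have h1 : u h.1.1 = y ⟨⟨h.1.1, h.1.2⟩, trivial⟩ := dif_pos h.1.2
    rw [halfDefect, h2, sub_zero, h1]
  -- Only the jump across each edge matters: after moving it to the end $\infty$, the error has
  -- equal end values on each edge other than $e_0$, hence is the defect of a global section.
  let w : {e : E // e ≠ e₀} → ℂ := fun e => u (e.1, true) - u (e.1, false)
  refine ⟨w, ?_⟩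
  change edgeClass G e₀ q (halfDefect G e₀ q (extendHalf e₀ w)) = edgeClass G e₀ q y
  rw [← sub_eq_zero, ← map_sub, edgeClass_eq_zero_iff]
  obtain ⟨f, hf, hfu⟩ := exists_normalization_section (G := G) (e₀ := e₀) (q := q)
    (u := extendHalf e₀ w - u) fun e he => by
      simp only [Pi.sub_apply, extendHalf_true w he, extendHalf_false, w]
      ring
  refine ⟨f, hf, ?_⟩
  rw [gluingDefect_eq_halfDefect hfu, hy]
  funext h
  simp only [halfDefect, Pi.sub_apply]
  ring

theorem ker_cochainClass [DecidableEq E] :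
    LinearMap.ker (cochainClass G e₀ q) = LinearMap.range (coboundary G e₀) := by
  ext w
  rw [LinearMap.mem_ker, LinearMap.mem_range]
  refine (edgeClass_eq_zero_iff (halfDefect G e₀ q (extendHalf e₀ w))).trans ?_
  constructor
  · rintro ⟨f, hf, hfw⟩
    let u : E × Bool → ℂ := fun h => valueAt (endPoint h.2) (f ⟨h.1, trivial⟩)
    have hu : ∀ e b, HasValueAt (endPoint b) (f ⟨e, trivial⟩) (u (e, b)) := fun e b =>
      hasValueAt_valueAt (hf.2 ⟨e, trivial⟩ b trivial)
    rw [gluingDefect_eq_halfDefect hu] at hfw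
    -- The difference of the two half-edge functions has zero defect, so it descends to the
    -- vertices; its coboundary is `w`, because the section is constant on each edge other than
    -- $e_0$.
    let l : V → ℂ := fun v => extendHalf e₀ w (G.baseHalf v) - u (G.baseHalf v)
    have hl : ∀ h : E × Bool, l (G.endpt h.1 h.2) = extendHalf e₀ w h - u h := by
      intro h
      by_cases hb : h = G.baseHalf (G.endpt h.1 h.2)
      · simp only [l]
        rw [← hb]
      · have := congrFun hfw ⟨⟨h, hb⟩, trivial⟩
        simp only [halfDefect] at this
        simp only [l]
        linear_combination this
    refine ⟨l, funext fun e => ?_⟩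
    change l (G.endpt e.1 true) - l (G.endpt e.1 false) = w e
    have h1 := hl (e.1, true)
    have h2 := hl (e.1, false)
    rw [extendHalf_true w e.2] at h1
    rw [extendHalf_false] at h2
    obtain ⟨c, hc⟩ := section_eq_C hf e.2
    have h3 : u (e.1, true) = c := (hc ▸ hu e.1 true).unique (hasValueAt_C _ c)
    have h4 : u (e.1, false) = c := (hc ▸ hu e.1 false).unique (hasValueAt_C _ c)
    simp only at h1 h2
    rw [h1, h2, h3, h4]
    simp
  · rintro ⟨l, rfl⟩
    obtain ⟨f, hf, hfu⟩ := exists_normalization_section (G := G) (e₀ := e₀) (q := q)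
      (u := extendHalf e₀ (coboundary G e₀ l) - fun h => l (G.endpt h.1 h.2)) fun e he => by
        simp only [Pi.sub_apply, extendHalf_true _ he, extendHalf_false, coboundary,
          LinearMap.coe_mk, AddHom.coe_mk]
        ring
    refine ⟨f, hf, ?_⟩
    rw [gluingDefect_eq_halfDefect hfu]
    funext h
    have := congrFun (halfDefect_endpt (G := G) (e₀ := e₀) (q := q) l) h
    simp only [halfDefect, Pi.zero_apply] at this
    simp only [halfDefect, Pi.sub_apply]
    linear_combination -this

/-- `H¹(𝒪)` is the first cohomology of the graph with the edge `e₀` removed. -/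
def cochainClassEquiv [DecidableEq E] (G : TrivalentGraph V E) (e₀ : E) (q : ℂˣ) :
    (({e : E // e ≠ e₀} → ℂ) ⧸ LinearMap.range (coboundary G e₀)) ≃ₗ[ℂ]
      (structureSheaf G e₀ q).H1 :=
  (Submodule.quotEquivOfEq _ _ ker_cochainClass.symm).trans
    ((cochainClass G e₀ q).quotKerEquivOfSurjective cochainClass_surjective)

theorem smul_structureSheaf_H1 [DecidableEq E] {a : GlobalFunctions G e₀ q} {c : ℂ}
    (hc : HasNodeValue a c) (x : (structureSheaf G e₀ q).H1) : a • x = c • x := by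
  obtain ⟨w, rfl⟩ := cochainClass_surjective x
  exact smul_cochainClass hc w

end TrivalentGraph

/-! ### The nodal cubic -/

/-- The coordinate function `Y` on the nodal cubic. -/
def nodalY : NodalCubic := Ideal.Quotient.mk nodalCubicIdeal (MvPolynomial.X 0)

/-- The coordinate function `Z` on the nodal cubic. -/
def nodalZ : NodalCubic := Ideal.Quotient.mk nodalCubicIdeal (MvPolynomial.X 1)

theorem nodal_relation : nodalZ * nodalZ = nodalY * nodalZ - nodalY ^ 3 := by
  have h : Ideal.Quotient.mk nodalCubicIdeal (MvPolynomial.X 0 * MvPolynomial.X 1 -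
      MvPolynomial.X 0 ^ 3 - MvPolynomial.X 1 ^ 2) = 0 :=
    Ideal.Quotient.eq_zero_iff_mem.2 (Ideal.subset_span rfl)
  simp only [map_sub, map_mul, map_pow] at h
  change nodalY * nodalZ - nodalY ^ 3 - nodalZ ^ 2 = 0 at h
  linear_combination -h

theorem exists_nodal_normal_form (x : NodalCubic) : ∃ a b : Polynomial ℂ,
    x = Polynomial.aeval nodalY a + Polynomial.aeval nodalY b * nodalZ := by
  obtain ⟨P, rfl⟩ := Ideal.Quotient.mk_surjective x
  induction P using MvPolynomial.induction_on with
  | C c => exact ⟨Polynomial.C c, 0, by simp; rfl⟩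
  | add P Q hP hQ =>
    obtain ⟨a, b, h⟩ := hP
    obtain ⟨a', b', h'⟩ := hQ
    exact ⟨a + a', b + b', by rw [map_add, h, h', map_add, map_add]; ring⟩
  | mul_X P i hP =>
    obtain ⟨a, b, h⟩ := hP
    rw [map_mul, h]
    match i with
    | 0 =>
      refine ⟨a * Polynomial.X, b * Polynomial.X, ?_⟩
      change _ * nodalY = _
      simp only [map_mul, Polynomial.aeval_X]
      ring
    | 1 =>
      -- The relation $Z^2=YZ-Y^3$ reduces $(a+bZ)Z$.
      refine ⟨-(b * Polynomial.X ^ 3), a + b * Polynomial.X, ?_⟩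
      change _ * nodalZ = _
      simp only [map_neg, map_add, map_mul, map_pow, Polynomial.aeval_X]
      linear_combination Polynomial.aeval nodalY b * nodal_relation

/-- The function `t - t²` on the affine line, which is the coordinate `Y` of the normalization of
the nodal cubic. -/
def foldPoly : Polynomial ℂ := Polynomial.X - Polynomial.X ^ 2

theorem natDegree_foldPoly : foldPoly.natDegree = 2 := by
  unfold foldPoly
  compute_degree!

/-- The normalization map of the nodal cubic, on functions. -/
def nodalMap : NodalCubic →ₐ[ℂ] Polynomial ℂ :=
  Ideal.Quotient.liftₐ nodalCubicIdeal
    (MvPolynomial.aeval ![foldPoly, Polynomial.X * foldPoly]) (by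
      intro a ha
      have hle : nodalCubicIdeal ≤ RingHom.ker (MvPolynomial.aeval (R := ℂ)
          ![foldPoly, Polynomial.X * foldPoly]) := by
        refine Ideal.span_le.2 ?_
        rintro _ rfl
        simp only [SetLike.mem_coe, RingHom.mem_ker, map_sub, map_mul, map_pow,
          MvPolynomial.aeval_X, Matrix.cons_val_zero, Matrix.cons_val_one]
        unfold foldPoly
        ring
      exact hle ha)

theorem nodalMap_Y : nodalMap nodalY = foldPoly := by
  change MvPolynomial.aeval _ (MvPolynomial.X 0) = _
  simp

theorem nodalMap_Z : nodalMap nodalZ = Polynomial.X * foldPoly := by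
  change MvPolynomial.aeval _ (MvPolynomial.X 1) = _
  simp

theorem nodalMap_normal_form (a b : Polynomial ℂ) :
    nodalMap (Polynomial.aeval nodalY a + Polynomial.aeval nodalY b * nodalZ) =
      a.comp foldPoly + (b * Polynomial.X).comp foldPoly * Polynomial.X := by
  rw [map_add, map_mul, ← Polynomial.aeval_algHom_apply, ← Polynomial.aeval_algHom_apply,
    nodalMap_Y, nodalMap_Z, Polynomial.mul_comp, Polynomial.X_comp]
  change a.comp foldPoly + b.comp foldPoly * _ = _
  ring

/-- The substituted polynomial has degree two, so the first term has even degree and the second odd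
degree; they cannot cancel. -/
theorem eq_zero_of_comp_foldPoly {a b : Polynomial ℂ}
    (h : a.comp foldPoly + b.comp foldPoly * Polynomial.X = 0) : a = 0 ∧ b = 0 := by
  have hinj : ∀ c : Polynomial ℂ, c.comp foldPoly = 0 → c = 0 := by
    intro c hc
    rcases Polynomial.comp_eq_zero_iff.1 hc with h0 | ⟨-, h0⟩
    · exact h0
    · have := natDegree_foldPoly
      rw [h0, Polynomial.natDegree_C] at this
      omega
  have hb : b = 0 := by
    by_contra hb
    have hb' : b.comp foldPoly ≠ 0 := fun h' => hb (hinj b h')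
    have h1 : a.comp foldPoly = -(b.comp foldPoly * Polynomial.X) := eq_neg_of_add_eq_zero_left h
    have h2 := congrArg Polynomial.natDegree h1
    rw [Polynomial.natDegree_neg, Polynomial.natDegree_mul_X hb', Polynomial.natDegree_comp,
      Polynomial.natDegree_comp, natDegree_foldPoly] at h2
    omega
  refine ⟨hinj a ?_, hb⟩
  simpa [hb] using h

theorem exists_comp_foldPoly (p : Polynomial ℂ) : ∃ a b : Polynomial ℂ,
    p = a.comp foldPoly + b.comp foldPoly * Polynomial.X := by
  induction p using Polynomial.induction_on with
  | C c => exact ⟨Polynomial.C c, 0, by simp⟩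
  | add P Q hP hQ =>
    obtain ⟨a, b, h⟩ := hP
    obtain ⟨a', b', h'⟩ := hQ
    refine ⟨a + a', b + b', ?_⟩
    rw [Polynomial.add_comp, Polynomial.add_comp]
    linear_combination h + h'
  | monomial n c h =>
    obtain ⟨a, b, h⟩ := h
    -- This rewrites $(a+bt)t$ by means of $t^2=t-Y$.
    refine ⟨-(b * Polynomial.X), a + b, ?_⟩
    rw [pow_succ, ← mul_assoc, h, Polynomial.neg_comp, Polynomial.mul_comp, Polynomial.X_comp,
      Polynomial.add_comp]
    unfold foldPoly
    ring

theorem nodalMap_injective : Function.Injective nodalMap := by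
  rw [injective_iff_map_eq_zero]
  intro x hx
  obtain ⟨a, b, rfl⟩ := exists_nodal_normal_form x
  rw [nodalMap_normal_form] at hx
  obtain ⟨rfl, hb⟩ := eq_zero_of_comp_foldPoly hx
  have : b = 0 := by simpa using hb
  simp [this]

theorem eval_zero_foldPoly : foldPoly.eval 0 = 0 := by simp [foldPoly]

theorem eval_one_foldPoly : foldPoly.eval 1 = 0 := by simp [foldPoly]

theorem eval_one_nodalMap (x : NodalCubic) : (nodalMap x).eval 1 = (nodalMap x).eval 0 := by
  obtain ⟨a, b, rfl⟩ := exists_nodal_normal_form x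
  rw [nodalMap_normal_form]
  simp [Polynomial.eval_comp, eval_zero_foldPoly, eval_one_foldPoly]

/-- Over $\mathbb{C}[Y]$ write $p=a+bt$. The two values differ by $b(0)$, so equality makes $b$
divisible by $Y$, and $Yt$ is the image of $Z$. -/
theorem exists_nodalMap_eq {p : Polynomial ℂ} (h : p.eval 1 = p.eval 0) :
    ∃ x, nodalMap x = p := by
  obtain ⟨a, b, rfl⟩ := exists_comp_foldPoly p
  simp only [Polynomial.eval_add, Polynomial.eval_mul, Polynomial.eval_comp, eval_zero_foldPoly,
    eval_one_foldPoly, Polynomial.eval_X, mul_one, mul_zero, add_zero, add_eq_left] at h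
  obtain ⟨c, rfl⟩ := Polynomial.X_dvd_iff.2 ((Polynomial.coeff_zero_eq_eval_zero b).trans h)
  refine ⟨Polynomial.aeval nodalY a + Polynomial.aeval nodalY c * nodalZ, ?_⟩
  rw [nodalMap_normal_form, mul_comm c]

/-- The value of a function on the nodal cubic at the node. -/
def nodeEval : NodalCubic →ₐ[ℂ] ℂ := (Polynomial.aeval (0 : ℂ)).comp nodalMap

theorem nodeEval_apply (x : NodalCubic) : nodeEval x = (nodalMap x).eval 0 := by
  simp [nodeEval]

theorem nodeIdeal_eq_ker : nodeIdeal = RingHom.ker nodeEval := by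
  have hY : nodalY ∈ nodeIdeal := Ideal.subset_span (Or.inl rfl)
  have hZ : nodalZ ∈ nodeIdeal := Ideal.subset_span (Or.inr rfl)
  refine le_antisymm (Ideal.span_le.2 ?_) fun x hx => ?_
  · rintro _ (rfl | rfl)
    · change nodeEval nodalY = 0
      rw [nodeEval_apply, nodalMap_Y, eval_zero_foldPoly]
    · change nodeEval nodalZ = 0
      rw [nodeEval_apply, nodalMap_Z]
      simp
  · obtain ⟨a, b, rfl⟩ := exists_nodal_normal_form x
    rw [RingHom.mem_ker, nodeEval_apply, nodalMap_normal_form] at hx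
    simp only [Polynomial.eval_add, Polynomial.eval_mul, Polynomial.eval_comp,
      eval_zero_foldPoly, Polynomial.eval_X, mul_zero, add_zero] at hx
    obtain ⟨c, rfl⟩ := Polynomial.X_dvd_iff.2 ((Polynomial.coeff_zero_eq_eval_zero a).trans hx)
    refine add_mem ?_ (Ideal.mul_mem_left _ _ hZ)
    rw [map_mul, Polynomial.aeval_X]
    exact Ideal.mul_mem_right _ _ hY

theorem nodeModule_smul (x : NodalCubic) (n : NodeModule) : x • n = nodeEval x • n := by
  obtain ⟨y, rfl⟩ := Ideal.Quotient.mk_surjective n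
  rw [← Ideal.Quotient.mk_eq_mk, ← Submodule.Quotient.mk_smul, ← Submodule.Quotient.mk_smul,
    Submodule.Quotient.eq, nodeIdeal_eq_ker, RingHom.mem_ker, map_sub, smul_eq_mul, map_mul,
    AlgHom.map_smul_of_tower, smul_eq_mul, sub_self]

/-- The residue field of the node is `ℂ`. -/
def nodeModuleEquiv : ℂ ≃ₗ[ℂ] NodeModule :=
  LinearEquiv.ofBijective (Algebra.linearMap ℂ NodeModule) (by
    constructor
    · rw [injective_iff_map_eq_zero]
      intro c hc
      have h : algebraMap ℂ NodalCubic c ∈ nodeIdeal := Ideal.Quotient.eq_zero_iff_mem.1 hc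
      rw [nodeIdeal_eq_ker, RingHom.mem_ker, AlgHom.commutes] at h
      exact h
    · intro n
      obtain ⟨y, rfl⟩ := Ideal.Quotient.mk_surjective n
      refine ⟨nodeEval y, ?_⟩
      change Ideal.Quotient.mk nodeIdeal (algebraMap ℂ NodalCubic (nodeEval y)) = _
      rw [Ideal.Quotient.mk_eq_mk_iff_sub_mem, nodeIdeal_eq_ker, RingHom.mem_ker, map_sub,
        AlgHom.commutes]
      exact sub_self _)

namespace TrivalentGraph

variable {V E : Type} {G : TrivalentGraph V E} {e₀ : E} {q : ℂˣ}

/-! ### Global functions -/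

/-- A global function is constant along every edge other than $e_0$, and these edges connect all
vertices. -/
theorem IsNonseparating.exists_hasNodeValue (h : G.IsNonseparating e₀)
    (a : GlobalFunctions G e₀ q) : ∃ c, HasNodeValue a c := by
  choose l hl using fun v => a.2.2 v trivial
  have hn := (mem_regularFunctions_iff.1 a.2).1
  have h0 : coboundary G e₀ l = 0 := by
    funext e
    obtain ⟨c, hc⟩ := section_eq_C hn e.2
    have hv : ∀ b, l (G.endpt e.1 b) = c := fun b =>
      (hl _ ⟨e.1, trivial⟩ b rfl).unique (hc ▸ hasValueAt_C _ c)
    change l _ - l _ = 0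
    rw [hv, hv, sub_self]
  refine ⟨l (G.endpt e₀ false), fun e b => ?_⟩
  rw [h.eq_of_coboundary_eq_zero h0 _ (G.endpt e.1 b)]
  exact hl _ e b rfl

section

variable [DecidableEq E]

/-- The family of functions on the components defined by a function on the nodal cubic. -/
def nodalFamily (G : TrivalentGraph V E) (e₀ : E) (q : ℂˣ) :
    NodalCubic →ₐ[ℂ] (Comp (⊤ : Opens (Punctured G e₀ q)) → RatFunc ℂ) :=
  AlgHom.pi fun e => if e.1 = e₀ then (Polynomial.aeval (affineCoord q)).comp nodalMap
    else (Algebra.ofId ℂ (RatFunc ℂ)).comp nodeEval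

theorem nodalFamily_self (x : NodalCubic) : nodalFamily G e₀ q x ⟨e₀, trivial⟩ =
    Polynomial.aeval (affineCoord q) (nodalMap x) := by
  simp [nodalFamily]

theorem nodalFamily_ne (x : NodalCubic) {e : E} (he : e ≠ e₀) :
    nodalFamily G e₀ q x ⟨e, trivial⟩ = RatFunc.C (nodeEval x) := by
  simp [nodalFamily, he, Algebra.ofId_apply, RatFunc.algebraMap_eq_C]

theorem hasValueAt_nodalFamily (x : NodalCubic) (e : E) (b : Bool) :
    HasValueAt (endPoint b) (nodalFamily G e₀ q x ⟨e, trivial⟩) (nodeEval x) := by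
  by_cases he : e = e₀
  · subst he
    rw [nodalFamily_self, nodeEval_apply]
    cases b
    · exact hasValueAt_aeval_zero q _
    · rw [← eval_one_nodalMap]
      exact hasValueAt_aeval_infty q _
  · rw [nodalFamily_ne x he]
    exact hasValueAt_C _ _

theorem nodalFamily_mem (x : NodalCubic) :
    nodalFamily G e₀ q x ∈ regularFunctions (⊤ : Opens (Punctured G e₀ q)) := by
  refine ⟨fun ⟨e, _⟩ z hz _ => ?_, fun v _ => ⟨nodeEval x, fun e b _ =>
    hasValueAt_nodalFamily x e.1 b⟩⟩
  by_cases he : e = e₀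
  · subst he
    rw [nodalFamily_self]
    refine pointVal_aeval_le (fun h => hz ?_) _
    have : z = q := Units.ext (by simpa using h)
    rw [this]
  · rw [nodalFamily_ne x he]
    exact pointVal_C_le _ _

/-- Functions on the nodal cubic as global functions on the punctured configuration. -/
def nodalGlobal (G : TrivalentGraph V E) (e₀ : E) (q : ℂˣ) :
    NodalCubic →ₐ[ℂ] GlobalFunctions G e₀ q :=
  (nodalFamily G e₀ q).codRestrict (regularFunctions ⊤) nodalFamily_mem

theorem hasNodeValue_nodalGlobal (x : NodalCubic) :
    HasNodeValue (nodalGlobal G e₀ q x) (nodeEval x) :=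
  fun e b => hasValueAt_nodalFamily x e.1 b

theorem nodalGlobal_injective : Function.Injective (nodalGlobal G e₀ q) := by
  intro x y h
  have h1 : nodalFamily G e₀ q x ⟨e₀, trivial⟩ = nodalFamily G e₀ q y ⟨e₀, trivial⟩ :=
    congrFun (congrArg Subtype.val h) _
  rw [nodalFamily_self, nodalFamily_self] at h1
  exact nodalMap_injective (aeval_affineCoord_injective q h1)

theorem IsNonseparating.nodalGlobal_surjective (h : G.IsNonseparating e₀) :
    Function.Surjective (nodalGlobal G e₀ q) := by
  intro a
  have hn := (mem_regularFunctions_iff.1 a.2).1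
  obtain ⟨P, hP⟩ := section_eq_aeval hn
  obtain ⟨c, hc⟩ := h.exists_hasNodeValue a
  have h0 : P.eval 0 = c :=
    (hasValueAt_aeval_zero q P).unique (hP ▸ hc ⟨e₀, trivial⟩ false)
  have h1 : P.eval 1 = c :=
    (hasValueAt_aeval_infty q P).unique (hP ▸ hc ⟨e₀, trivial⟩ true)
  obtain ⟨x, rfl⟩ := exists_nodalMap_eq (h1.trans h0.symm)
  refine ⟨x, Subtype.ext (funext fun ⟨e, _⟩ => ?_)⟩
  change nodalFamily G e₀ q x ⟨e, trivial⟩ = a.1 ⟨e, trivial⟩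
  by_cases he : e = e₀
  · subst he
    rw [nodalFamily_self, hP]
  · obtain ⟨d, hd⟩ := section_eq_C hn he
    have : d = c := (hasValueAt_C _ d).unique (hd ▸ hc ⟨e, trivial⟩ false)
    rw [nodalFamily_ne x he, nodeEval_apply, h0, hd, this]

/-- The ring of global functions is the ring of functions on the nodal cubic. -/
def globalEquiv (h : G.IsNonseparating e₀) (q : ℂˣ) : NodalCubic ≃ₐ[ℂ] GlobalFunctions G e₀ q :=
  AlgEquiv.ofBijective (nodalGlobal G e₀ q) ⟨nodalGlobal_injective, h.nodalGlobal_surjective⟩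

end

end TrivalentGraph

namespace TrivalentGraph

variable {V E : Type} {G : TrivalentGraph V E} {e₀ : E} {q : ℂˣ}

/-! ### Balanced vector fields -/

theorem exists_node_values {U : Opens (Punctured G e₀ q)} {f : Comp U → RatFunc ℂ}
    (hf : f ∈ (normalizationSheaf G e₀ q).sec U) :
    ∃ ρ : E × Bool → ℂ, ∀ (e : Comp U) (b : Bool), nodePt G e₀ q (G.endpt e.1 b) ∈ U →
      HasValueAt (endPoint b) (f e) (ρ (e.1, b)) := by
  classical
  refine ⟨fun h => if hh : genericPt G e₀ q h.1 ∈ U then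
    valueAt (endPoint h.2) (f ⟨h.1, hh⟩) else 0, fun e b hv => ?_⟩
  simp only [dif_pos e.2]
  exact hasValueAt_valueAt (hf.2 e b hv)

variable [Fintype E] [DecidableEq V]

/-- In terms of coefficients of $x\partial_x$, balanced fields are sections of the normalization
sheaf subject to one signed linear condition at each node, so the Cousin theory for functions
applies. -/
theorem mem_balanced_iff {U : Opens (Punctured G e₀ q)} {D : Comp U → RatVec} :
    D ∈ (balancedVectorFields G e₀ q).sec U ↔
      (fun e => vecCoeff (D e)) ∈ (normalizationSheaf G e₀ q).sec U ∧
      ∀ v, nodePt G e₀ q v ∈ U → ∃ ρ : E × Bool → ℂ,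
        (∀ (e : Comp U) (b : Bool), G.endpt e.1 b = v →
          HasValueAt (endPoint b) (vecCoeff (D e)) (ρ (e.1, b))) ∧
        ∑ h : E × Bool with G.endpt h.1 h.2 = v, endSign h.2 * ρ h = 0 := by
  constructor
  · rintro ⟨h1, h2⟩
    refine ⟨⟨fun e z hz h => (vecRegularAt_iff z.ne_zero _).1 (h1 e z hz h), fun e b h => ?_⟩,
      fun v hv => ?_⟩
    · obtain ⟨ρ, hρ, -⟩ := h2 _ h
      exact ((hasRotationAt_endPoint_iff _ _ _).1 (hρ e b rfl)).regular
    · obtain ⟨ρ, hρ, hs⟩ := h2 v hv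
      refine ⟨fun h => endSign h.2 * ρ h, fun e b h =>
        (hasRotationAt_endPoint_iff _ _ _).1 (hρ e b h), ?_⟩
      simpa only [← mul_assoc, endSign_mul_self, one_mul] using hs
  · rintro ⟨h1, h2⟩
    refine ⟨fun e z hz h => (vecRegularAt_iff z.ne_zero _).2 (h1.1 e z hz h), fun v hv => ?_⟩
    obtain ⟨ρ, hρ, hs⟩ := h2 v hv
    refine ⟨fun h => endSign h.2 * ρ h, fun e b h =>
      (hasRotationAt_endPoint_iff _ _ _).2 ?_, hs⟩
    rw [← mul_assoc, endSign_mul_self, one_mul]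
    exact hρ e b h

variable [DecidableEq E]

/-- Off $e_0$ both ends carry the same value, so the balance at a vertex splits into the
contribution of $e_0$ and a divergence. -/
theorem sum_endSign_eq (u : E × Bool → ℂ) (κ : {e : E // e ≠ e₀} → ℂ)
    (hu : ∀ (e : {e : E // e ≠ e₀}) b, u (e.1, b) = κ e) (v : V) :
    ∑ h : E × Bool with G.endpt h.1 h.2 = v, endSign h.2 * u h =
      ((if G.endpt e₀ false = v then u (e₀, false) else 0) -
        (if G.endpt e₀ true = v then u (e₀, true) else 0)) + divergence G e₀ κ v := by
  rw [Finset.sum_filter, Fintype.sum_prod_type, Fintype.sum_eq_add_sum_subtype_ne _ e₀]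
  simp only [Fintype.sum_bool, endSign, one_mul, neg_one_mul, divergence, LinearMap.coe_mk,
    AddHom.coe_mk, hu]
  congr 1
  · split_ifs <;> ring
  · refine Finset.sum_congr rfl fun e _ => ?_
    split_ifs <;> ring

variable [Fintype V]

theorem IsNonseparating.exists_half_function (h : G.IsNonseparating e₀) (μ : V → ℂ) :
    ∃ u : E × Bool → ℂ, (∀ e, e ≠ e₀ → u (e, true) = u (e, false)) ∧
      ∀ v, ∑ h : E × Bool with G.endpt h.1 h.2 = v, endSign h.2 * u h = μ v := by
  -- The total of `μ` is placed at the end $0$ of $e_0$, with zero at the end $\infty$; what remains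
  -- has sum zero and is a divergence.
  obtain ⟨κ, hκ⟩ := (h.mem_range_divergence
    (fun v => μ v - if G.endpt e₀ false = v then ∑ w, μ w else 0)).2 (by
      simp [Finset.sum_sub_distrib])
  refine ⟨fun k => if hk : k.1 = e₀ then (if k.2 then 0 else ∑ w, μ w) else κ ⟨k.1, hk⟩,
    fun e he => by simp [he], fun v => ?_⟩
  rw [sum_endSign_eq _ κ (fun e b => by simp [e.2]), hκ]
  simp

theorem IsNonseparating.subsingleton_H1_balanced (h : G.IsNonseparating e₀) :
    Subsingleton (balancedVectorFields G e₀ q).H1 := by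
  refine SectionSheaf.subsingleton_H1 _ fun U hU s hs => ?_
  have hs' := fun x y => mem_balanced_iff.1 (hs x y)
  obtain ⟨r, hr⟩ := exists_normalization_cousin U hU (fun x e => vecCoeff (s x e)) (fun x y => by
    convert (hs' x y).1 using 1
    funext e
    exact (map_sub vecCoeff _ _).symm)
  choose ρ hρ using fun v => exists_node_values (hr (nodePt G e₀ q v))
  -- The imbalance at $v$ is measured against the datum chosen at the node $v$ itself, and a global
  -- section with the same imbalance is subtracted.
  obtain ⟨u, hu, hsum⟩ := h.exists_half_function fun v =>
    ∑ k : E × Bool with G.endpt k.1 k.2 = v, endSign k.2 * ρ v k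
  obtain ⟨f, hf, hfu⟩ := exists_normalization_section (G := G) (e₀ := e₀) (q := q) hu
  refine ⟨fun e => vecCoeff.symm (r e - f e), fun x => mem_balanced_iff.2 ⟨?_, fun v hv => ?_⟩⟩
  · have h1 := sub_mem (hr x) ((normalizationSheaf G e₀ q).restr_mem (le_top : U x ≤ ⊤) hf)
    convert h1 using 1
    funext e
    simp only [Pi.sub_apply, restr, map_sub, LinearEquiv.apply_symm_apply]
    ring
  · obtain ⟨τ, hτ, hτs⟩ := (hs' x (nodePt G e₀ q v)).2 v ⟨hv, hU _⟩
    -- On $U_x$ the coefficient is $(r-s_v)-f-(s_x-s_v)$: the first two terms have cancelling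
    -- imbalances and the last is balanced by hypothesis.
    refine ⟨fun k => ρ v k - u k - τ k, fun e b heb => ?_, ?_⟩
    · have hmem : genericPt G e₀ q e.1 ∈ U (nodePt G e₀ q v) := by
        subst heb
        exact generic_mem_of_node_mem (hU _)
      have h1 := hρ v ⟨e.1, hmem⟩ b (by rw [heb]; exact hU _)
      have h2 := hτ ⟨e.1, e.2, hmem⟩ b heb
      have h3 := (h1.sub (hfu e.1 b)).sub h2
      convert h3 using 1
      simp only [Pi.sub_apply, restr, map_sub, LinearEquiv.apply_symm_apply]
      ring
    · simp only [mul_sub, Finset.sum_sub_distrib]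
      rw [hτs, hsum v, sub_self, sub_zero]

/-! ### Global balanced vector fields -/

theorem IsNonseparating.exists_base_flow (h : G.IsNonseparating e₀) :
    ∃ κ : {e : E // e ≠ e₀} → ℂ, ∀ v, divergence G e₀ κ v =
      (if G.endpt e₀ true = v then 1 else 0) - (if G.endpt e₀ false = v then 1 else 0) := by
  obtain ⟨κ, hκ⟩ := (h.mem_range_divergence (fun v =>
    (if G.endpt e₀ true = v then 1 else 0) - (if G.endpt e₀ false = v then 1 else 0))).2 (by
      simp [Finset.sum_sub_distrib])
  exact ⟨κ, fun v => congrFun hκ v⟩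

/-- A flow on the edges other than `e₀` that carries one unit from one end of `e₀` to the other. -/
def baseFlow (h : G.IsNonseparating e₀) : {e : E // e ≠ e₀} → ℂ := h.exists_base_flow.choose

theorem divergence_baseFlow (h : G.IsNonseparating e₀) (v : V) :
    divergence G e₀ (baseFlow h) v =
      (if G.endpt e₀ true = v then 1 else 0) - (if G.endpt e₀ false = v then 1 else 0) :=
  h.exists_base_flow.choose_spec v

/-- The coefficients of a global balanced vector field. -/
def fieldCoeff (h : G.IsNonseparating e₀) (q : ℂˣ)
    (x : NodalCubic × LinearMap.ker (divergence G e₀)) (e : E) : RatFunc ℂ :=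
  if he : e = e₀ then Polynomial.aeval (affineCoord q) (nodalMap x.1)
    else RatFunc.C (x.2.1 ⟨e, he⟩ + nodeEval x.1 * baseFlow h ⟨e, he⟩)

theorem fieldCoeff_self (h : G.IsNonseparating e₀)
    (x : NodalCubic × LinearMap.ker (divergence G e₀)) :
    fieldCoeff h q x e₀ = Polynomial.aeval (affineCoord q) (nodalMap x.1) := dif_pos rfl

theorem fieldCoeff_ne (h : G.IsNonseparating e₀)
    (x : NodalCubic × LinearMap.ker (divergence G e₀)) (e : {e : E // e ≠ e₀}) :
    fieldCoeff h q x e.1 = RatFunc.C (x.2.1 e + nodeEval x.1 * baseFlow h e) := dif_neg e.2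

theorem fieldCoeff_add (h : G.IsNonseparating e₀)
    (x y : NodalCubic × LinearMap.ker (divergence G e₀)) (e : E) :
    fieldCoeff h q (x + y) e = fieldCoeff h q x e + fieldCoeff h q y e := by
  by_cases he : e = e₀
  · subst he
    simp [fieldCoeff_self]
  · have h1 := fun z => fieldCoeff_ne (q := q) h z ⟨e, he⟩
    simp only at h1
    rw [h1, h1, h1, ← map_add]
    congr 1
    simp
    ring

theorem field_mem (h : G.IsNonseparating e₀)
    (x : NodalCubic × LinearMap.ker (divergence G e₀)) :
    (fun e => vecCoeff.symm (fieldCoeff h q x e.1)) ∈ (balancedVectorFields G e₀ q).sec ⊤ := by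
  rw [mem_balanced_iff]
  simp only [LinearEquiv.apply_symm_apply]
  let κ : {e : E // e ≠ e₀} → ℂ := x.2.1 + nodeEval x.1 • baseFlow h
  let u : E × Bool → ℂ := fun k => if hk : k.1 = e₀ then nodeEval x.1 else κ ⟨k.1, hk⟩
  have hu : ∀ e b, HasValueAt (endPoint b) (fieldCoeff h q x e) (u (e, b)) := by
    intro e b
    by_cases he : e = e₀
    · subst he
      rw [fieldCoeff_self]
      simp only [u, dif_pos rfl]
      rw [nodeEval_apply]
      cases b
      · exact hasValueAt_aeval_zero q _
      · rw [← eval_one_nodalMap]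
        exact hasValueAt_aeval_infty q _
    · have := fieldCoeff_ne (q := q) h x ⟨e, he⟩
      simp only at this
      rw [this]
      simp only [u, dif_neg he]
      exact hasValueAt_C _ _
  refine ⟨⟨fun ⟨e, _⟩ z hz _ => ?_, fun e b _ => (hu e.1 b).regular⟩,
    fun v _ => ⟨u, fun e b _ => hu e.1 b, ?_⟩⟩
  · change pointVal _ (fieldCoeff h q x e) ≤ 1
    by_cases he : e = e₀
    · subst he
      rw [fieldCoeff_self]
      refine pointVal_aeval_le (fun hzq => hz ?_) _
      rw [Units.ext (by simpa using hzq : (z : ℂ) = q)]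
    · rw [fieldCoeff_ne h x ⟨e, he⟩]
      exact pointVal_C_le _ _
  -- The node value times the base flow compensates the equal end values on $e_0$; the closed flow
  -- contributes nothing.
  · rw [sum_endSign_eq u κ fun e b => by simp [u, e.2]]
    have h1 : divergence G e₀ κ v = nodeEval x.1 * divergence G e₀ (baseFlow h) v := by
      simp only [κ, map_add, map_smul, Pi.add_apply, Pi.smul_apply, smul_eq_mul]
      rw [LinearMap.mem_ker.1 x.2.2, Pi.zero_apply, zero_add]
    rw [h1, divergence_baseFlow]
    simp only [u, dif_pos]
    split_ifs <;> ring

/-- Global balanced vector fields from functions on the nodal cubic and closed flows. -/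
def fieldHom (h : G.IsNonseparating e₀) (q : ℂˣ) :
    NodalCubic × LinearMap.ker (divergence G e₀) →+ (balancedVectorFields G e₀ q).H0 :=
  AddMonoidHom.mk' (fun x => (⟨_, field_mem h x⟩ : (balancedVectorFields G e₀ q).sec ⊤))
    fun x y => Subtype.ext (funext fun e => by
      change vecCoeff.symm _ = vecCoeff.symm _ + vecCoeff.symm _
      rw [fieldCoeff_add, map_add])

theorem fieldHom_injective (h : G.IsNonseparating e₀) : Function.Injective (fieldHom h q) := by
  intro x y hxy
  have h1 : ∀ e, fieldCoeff h q x e = fieldCoeff h q y e := fun e =>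
    vecCoeff.symm.injective (congrFun (congrArg Subtype.val hxy) ⟨e, trivial⟩)
  have h2 := h1 e₀
  rw [fieldCoeff_self, fieldCoeff_self] at h2
  have h3 : x.1 = y.1 := nodalMap_injective (aeval_affineCoord_injective q h2)
  refine Prod.ext h3 (Subtype.ext (funext fun e => ?_))
  have h4 := h1 e.1
  rw [fieldCoeff_ne, fieldCoeff_ne, h3] at h4
  exact add_right_cancel (RatFunc.C_injective h4)

theorem fieldHom_surjective (h : G.IsNonseparating e₀) : Function.Surjective (fieldHom h q) := by
  intro D
  let D' : (balancedVectorFields G e₀ q).sec ⊤ := D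
  obtain ⟨hn, hb⟩ := mem_balanced_iff.1 D'.2
  obtain ⟨P, hP⟩ := section_eq_aeval hn
  choose c hc using fun e : {e : E // e ≠ e₀} => section_eq_C hn e.2
  let u : E × Bool → ℂ := fun k =>
    if hk : k.1 = e₀ then (if k.2 then P.eval 1 else P.eval 0) else c ⟨k.1, hk⟩
  have hu : ∀ (e : Comp (⊤ : Opens (Punctured G e₀ q))) b,
      HasValueAt (endPoint b) (vecCoeff (D'.1 e)) (u (e.1, b)) := by
    rintro ⟨e, _⟩ b
    by_cases he : e = e₀
    · subst he
      simp only at hP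
      rw [← hP]
      cases b
      · simpa [u] using! hasValueAt_aeval_zero q P
      · simpa [u] using! hasValueAt_aeval_infty q P
    · have := hc ⟨e, he⟩
      simp only at this
      rw [this]
      simp only [u, dif_neg he]
      exact hasValueAt_C _ _
  have hsum : ∀ v, ((if G.endpt e₀ false = v then P.eval 0 else 0) -
      (if G.endpt e₀ true = v then P.eval 1 else 0)) + divergence G e₀ c v = 0 := by
    intro v
    obtain ⟨ρ, hρ, hs⟩ := hb v trivial
    have h1 := sum_endSign_eq (G := G) (e₀ := e₀) u c (fun e b => by simp [u, e.2]) v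
    simp only [u, dif_pos] at h1
    refine Eq.trans ?_ (h1.symm.trans (Eq.trans ?_ hs))
    · simp
    · refine Finset.sum_congr rfl fun k hk => ?_
      rw [(hρ ⟨k.1, trivial⟩ k.2 (Finset.mem_filter.1 hk).2).unique (hu ⟨k.1, trivial⟩ k.2)]
  -- A divergence has total zero, so summing the balance over all vertices leaves only the two end
  -- values on $e_0$.
  have h01 : P.eval 1 = P.eval 0 := by
    have h1 : ∑ v, divergence G e₀ c v = 0 := (h.mem_range_divergence _).1 ⟨c, rfl⟩
    have h2 := Finset.sum_eq_zero fun v (_ : v ∈ Finset.univ) => hsum v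
    rw [Finset.sum_add_distrib, h1, Finset.sum_sub_distrib] at h2
    simp at h2
    linear_combination -h2
  obtain ⟨x, rfl⟩ := exists_nodalMap_eq h01
  -- Subtracting the node value times the base flow leaves a divergence-free flow.
  have hker : c - nodeEval x • baseFlow h ∈ LinearMap.ker (divergence G e₀) := by
    rw [LinearMap.mem_ker, map_sub, map_smul]
    funext v
    have := hsum v
    rw [h01, ← nodeEval_apply] at this
    simp only [Pi.sub_apply, Pi.smul_apply, smul_eq_mul, divergence_baseFlow, Pi.zero_apply]
    refine Eq.trans ?_ this
    split_ifs <;> ring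
  refine ⟨(x, ⟨_, hker⟩), Subtype.ext (funext fun ⟨e, _⟩ => ?_)⟩
  change vecCoeff.symm (fieldCoeff h q _ e) = D'.1 ⟨e, trivial⟩
  rw [LinearEquiv.symm_apply_eq]
  by_cases he : e = e₀
  · subst he
    rw [fieldCoeff_self]
    exact hP
  · rw [fieldCoeff_ne h _ ⟨e, he⟩]
    refine Eq.trans ?_ (hc ⟨e, he⟩).symm
    simp

theorem fieldHom_smul (h : G.IsNonseparating e₀) (y x : NodalCubic)
    (κ : LinearMap.ker (divergence G e₀)) :
    fieldHom h q (y * x, nodeEval y • κ) = nodalGlobal G e₀ q y • fieldHom h q (x, κ) := by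
  refine Subtype.ext (funext fun ⟨e, _⟩ => ?_)
  change vecCoeff.symm (fieldCoeff h q _ e) =
    nodalFamily G e₀ q y ⟨e, trivial⟩ • vecCoeff.symm (fieldCoeff h q _ e)
  rw [← map_smul, smul_eq_mul]
  congr 1
  by_cases he : e = e₀
  · subst he
    rw [fieldCoeff_self, fieldCoeff_self, nodalFamily_self, map_mul, map_mul]
  · rw [fieldCoeff_ne h _ ⟨e, he⟩, fieldCoeff_ne h _ ⟨e, he⟩, nodalFamily_ne y he, ← map_mul]
    congr 1
    simp
    ring

end TrivalentGraph

namespace TrivalentGraph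

variable {V E : Type} {G : TrivalentGraph V E} {e₀ : E} {q : ℂˣ}

/-! ### The even and the odd cohomology -/

/-- The even cohomology is the ring of global functions, since `H¹(T̃) = 0`. -/
def evenEquiv [Fintype V] [DecidableEq V] [Fintype E] [DecidableEq E]
    (h : G.IsNonseparating e₀) (q : ℂˣ) : EvenCohomology G e₀ q ≃ₐ[ℂ] GlobalFunctions G e₀ q :=
  AlgEquiv.ofBijective (TrivSqZeroExt.fstHom ℂ (GlobalFunctions G e₀ q)
    (balancedVectorFields G e₀ q).H1) (by
      have := h.subsingleton_H1_balanced (q := q)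
      exact ⟨fun x y hxy => TrivSqZeroExt.ext hxy (Subsingleton.elim _ _),
        TrivSqZeroExt.fst_surjective⟩)

theorem even_smul_odd [Fintype V] [DecidableEq V] [Fintype E] [DecidableEq E]
    (h : G.IsNonseparating e₀) (x : EvenCohomology G e₀ q) (m : OddCohomology G e₀ q) :
    x • m = (evenEquiv h q x • m.1, evenEquiv h q x • m.2) := rfl

/-- Each factor has dimension $|E|-|V|$, and $2|E|=3|V|$. -/
theorem finrank_H1_prod_flows [Fintype V] [DecidableEq V] [Fintype E] [DecidableEq E]
    (h : G.IsNonseparating e₀) (q : ℂˣ) :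
    FiniteDimensional ℂ ((structureSheaf G e₀ q).H1 × LinearMap.ker (divergence G e₀)) ∧
    Module.finrank ℂ ((structureSheaf G e₀ q).H1 × LinearMap.ker (divergence G e₀)) =
      Fintype.card V := by
  have hV : Nonempty V := ⟨G.endpt e₀ false⟩
  have : FiniteDimensional ℂ (structureSheaf G e₀ q).H1 :=
    (cochainClassEquiv G e₀ q).finiteDimensional
  refine ⟨inferInstance, ?_⟩
  rw [Module.finrank_prod, ← (cochainClassEquiv G e₀ q).finrank_eq]
  have h1 := finrank_quotient_range_coboundary h
  have h2 := finrank_ker_divergence h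
  have h3 := two_mul_card_edges G
  omega

end TrivalentGraph
end

/-! ### Assembly of the two isomorphisms. -/

theorem theorem2p2 (g : ℕ) (hg : 2 ≤ g) (V E : Type) [Fintype V] [DecidableEq V] [Fintype E]
    (hV : Fintype.card V = 2 * g - 2) (G : TrivalentGraph V E) (e₀ : E)
    (he₀ : G.IsNonseparating e₀) (q : ℂˣ) :
    ∃ (φ : G.EvenCohomology e₀ q ≃ₐ[ℂ] NodalCubic)
      (ψ : G.OddCohomology e₀ q ≃+ NodalCubic × (Fin (2 * g - 2) → NodeModule)),
      ∀ (x : G.EvenCohomology e₀ q) (m : G.OddCohomology e₀ q), ψ (x • m) = φ x • ψ m := by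
  classical
  obtain ⟨hfin, hrank⟩ := TrivalentGraph.finrank_H1_prod_flows he₀ q
  -- All of $H^1(\mathcal{O})$ and the flow part of $H^0(\tilde T)$ are modules over the residue
  -- field at the node, so a linear isomorphism chosen by dimension is enough.
  let L : ((G.structureSheaf e₀ q).H1 × LinearMap.ker (G.divergence e₀)) ≃ₗ[ℂ]
      (Fin (2 * g - 2) → NodeModule) :=
    (LinearEquiv.ofFinrankEq _ (Fin (2 * g - 2) → ℂ) (by rw [hrank, hV]; simp)).trans
      (LinearEquiv.piCongrRight fun _ => nodeModuleEquiv)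
  let Λ := AddEquiv.ofBijective (TrivalentGraph.fieldHom he₀ q)
    ⟨TrivalentGraph.fieldHom_injective he₀, TrivalentGraph.fieldHom_surjective he₀⟩
  let Θ := TrivalentGraph.globalEquiv he₀ q
  let φ : G.EvenCohomology e₀ q ≃ₐ[ℂ] NodalCubic :=
    (TrivalentGraph.evenEquiv he₀ q).trans Θ.symm
  let ψ : G.OddCohomology e₀ q ≃+ NodalCubic × (Fin (2 * g - 2) → NodeModule) :=
    { toFun := fun m => ((Λ.symm m.2).1, L (m.1, (Λ.symm m.2).2))
      invFun := fun p => ((L.symm p.2).1, Λ (p.1, (L.symm p.2).2))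
      left_inv := fun m => by simp
      right_inv := fun p => by simp
      map_add' := fun m m' => by
        rw [Prod.snd_add, map_add, Prod.fst_add, Prod.fst_add, Prod.snd_add]
        refine Prod.ext rfl ?_
        exact map_add L (m.1, (Λ.symm m.2).2) (m'.1, (Λ.symm m'.2).2) }
  refine ⟨φ, ψ, fun x m => ?_⟩
  obtain ⟨y, hy⟩ := Θ.surjective (TrivalentGraph.evenEquiv he₀ q x)
  have hφ : φ x = y := by
    change Θ.symm (TrivalentGraph.evenEquiv he₀ q x) = y
    rw [← hy, AlgEquiv.symm_apply_apply]
  rw [hφ, TrivalentGraph.even_smul_odd he₀, ← hy]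
  have h1 : Θ y • m.1 = nodeEval y • m.1 :=
    TrivalentGraph.smul_structureSheaf_H1 (TrivalentGraph.hasNodeValue_nodalGlobal y) m.1
  have h2 : Λ.symm (Θ y • m.2) = (y * (Λ.symm m.2).1, nodeEval y • (Λ.symm m.2).2) := by
    rw [AddEquiv.symm_apply_eq]
    refine Eq.trans ?_ (TrivalentGraph.fieldHom_smul he₀ y _ _).symm
    change _ = Θ y • Λ (Λ.symm m.2)
    rw [AddEquiv.apply_symm_apply]
  change ((Λ.symm (Θ y • m.2)).1, L (Θ y • m.1, (Λ.symm (Θ y • m.2)).2)) =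
    y • ((Λ.symm m.2).1, L (m.1, (Λ.symm m.2).2))
  rw [h1, h2]
  refine Prod.ext rfl ?_
  -- On both sides `y` acts by the scalar `nodeEval y`, so linearity of `L` over $\mathbb{C}$ is
  -- $A$-linearity.
  change L (nodeEval y • (m.1, (Λ.symm m.2).2)) = y • L (m.1, (Λ.symm m.2).2)
  rw [map_smul]
  funext i
  exact (nodeModule_smul y _).symm
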